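/- Let $q\in\mathbb C$ with $0<|q|<1$, and write $(a;q)_n=\prod_{j=0}^{n-1}(1-aq^j)$ for $n\in\mathbb Z_{\ge0}\cup\{\infty\}$ and $(a_1,\dots,a_m;q)_n=\prod_{r}(a_r;q)_n$. Let $b,c,d,e\in\mathbb C\setminus\{0\}$, and put $$F(z)=\frac{\bigl(\frac{cz}{d},\frac{c}{dz},\frac{cz}{e},\frac{c}{ez};q\bigr)_\infty}{\bigl(cz,\frac cz,\frac{c^2z}{bde},\frac{c^2}{bdez};q\bigr)_\infty},\qquad A(z)=\frac{\bigl(\frac{cz}{de},\frac{c}{dez};q\bigr)_\infty}{\bigl(\frac{c^2z}{bde},\frac{c^2}{bdez};q\bigr)_\infty},\qquad B(z)=\frac{\bigl(bz,\frac bz;q\bigr)_\infty}{\bigl(cz,\frac cz;q\bigr)_\infty},$$ $$H(z)=\frac{\bigl(\frac{cz}{d},\frac{c}{dz},\frac{cz}{e},\frac{c}{ez};q\bigr)_\infty}{\bigl(cz,\frac cz,\frac{cz}{de},\frac{c}{dez};q\bigr)_\infty},\qquad K(z)=\frac{\bigl(\frac{cz}{d},\frac{c}{dz},\frac{cz}{e},\frac{c}{ez};q\bigr)_\infty}{\bigl(bz,\frac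 bz,\frac{c^2z}{bde},\frac{c^2}{bdez};q\bigr)_\infty},$$ $$\Phi_k(z;b,c)=\frac{(bz,\frac bz;q)_k}{(cz,\frac cz;q)_k},\qquad \Psi_k(z;b,c,d,e)=\frac{\bigl(\frac{cz}{de},\frac{c}{dez};q\bigr)_k}{\bigl(\frac{c^2z}{bde},\frac{c^2}{bdez};q\bigr)_k},$$ $$f_k=\frac{1-bcq^{2k-1}}{1-bcq^{-1}}\,\frac{\bigl(bcq^{-1},d,e,\frac{c^2}{deq};q\bigr)_k}{\bigl(q,\frac{bc}{d},\frac{bc}{e},\frac{bdeq}{c};q\bigr)_k}\,q^k,$$ $$g_k=\frac{1-\frac{c^3q^{2k-1}}{bd^2e^2}}{1-\frac{c^3}{bd^2e^2q}}\,\frac{\bigl(\frac{c^3}{bd^2e^2q},\frac{c}{bd},\frac{c}{be},\frac{c^2}{deq};q\bigr)_k}{\bigl(q,\frac{c^2}{de^2},\frac{c^2}{d^2e},\frac{cq}{bde};q\bigr)_k}\,q^k .$$ Assume that the parameters are generic in the sense that the denominators of $H(b)$, of $K(c/(de))$, and of $f_k$ and $g_k$ for all $k\ge0$ are nonzero. Call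 $z\in\mathbb C\setminus\{0\}$ admissible if $z$ is none of the points $cq^m$, $(cq^m)^{-1}$, $\frac{c^2}{bde}q^m$, $\bigl(\frac{c^2}{bde}q^m\bigr)^{-1}$ with $m\ge0$. Then for every admissible $z$ both series below converge absolutely and $$F(z)=A(z)\,H(b)\sum_{k=0}^\infty f_k\,\Phi_k(z;b,c)+B(z)\,K\!\left(\tfrac{c}{de}\right)\sum_{k=0}^\infty g_k\,\Psi_k(z;b,c,d,e).$$ On every compact set $L$ of admissible points that is symmetric ($z\in L\Rightarrow z^{-1}\in L$), both series converge uniformly, and the right-hand side with both series truncated after $N$ terms converges uniformly to $F$ as $N\to\infty$. Equivalently, for every admissible $z$, in expanded form, $$F(z)=A(z)H(b)\sum_{k=0}^\infty\frac{1-bcq^{2k-1}}{1-bcq^{-1}}\frac{\bigl(bcq^{-1},d,e,\frac{c^2}{deq},bz,\frac bz;q\bigr)_k}{\bigl(q,\frac{bc}{d},\frac{bc}{e},\frac{bdeq}{c},cz,\frac cz;q\bigr)_k}q^k$$ $$\qquad+B(z)K\!\left(\tfrac{c}{de}\right)\sum_{k=0}^\infty\frac{1-\frac{c^3q^{2k-1}}{bd^2e^2}}{1-\frac{c^3}{bd^2e^2q}}\frac{\bigl(\frac{c^3}{bd^2e^2q},\frac{c}{bd},\frac{c}{be},\frac{c^2}{deq},\frac{cz}{de},\frac{c}{dez};q\bigr)_k}{\bigl(q,\frac{c^2}{de^2},\frac{c^2}{d^2e},\frac{cq}{bde},\frac{c^2z}{bde},\frac{c^2}{bdez};q\bigr)_k}q^k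 ,$$ that is, Bailey's nonterminating ${}_8\phi_7$ summation in kernel form: $$F(z)=A(z)H(b)\;{}_8W_7\!\left(\tfrac{bc}{q};d,e,\tfrac{c^2}{deq},bz,\tfrac bz;q,q\right)+B(z)K\!\left(\tfrac{c}{de}\right){}_8W_7\!\left(\tfrac{c^3}{bd^2e^2q};\tfrac{c}{bd},\tfrac{c}{be},\tfrac{c^2}{deq},\tfrac{cz}{de},\tfrac{c}{dez};q,q\right),$$ where ${}_8W_7(a;b_1,\dots,b_5;q,x)=\sum_{k\ge0}\frac{1-aq^{2k}}{1-a}\frac{(a,b_1,\dots,b_5;q)_k}{(q,aq/b_1,\dots,aq/b_5;q)_k}x^k$. -/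

import Mathlib

noncomputable section

namespace TwoBasis

/-- The finite `q`-shifted factorial `(a;q)_n = ∏_{j<n} (1 - a q^j)`. -/
def qPoch (q a : ℂ) (n : ℕ) : ℂ := ∏ j ∈ Finset.range n, (1 - a * q ^ j)

/-- The infinite `q`-shifted factorial `(a;q)_∞ = ∏_{j≥0} (1 - a q^j)`
(the product converges absolutely for `|q| < 1`). -/
def qPochInf (q a : ℂ) : ℂ := ∏' j : ℕ, (1 - a * q ^ j)

/-- `(a₁,…,a_m;q)_n`. -/
def qPochs (q : ℂ) (as : List ℂ) (n : ℕ) : ℂ := (as.map fun a => qPoch q a n).prod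

/-- `(a₁,…,a_m;q)_∞`. -/
def qPochsInf (q : ℂ) (as : List ℂ) : ℂ := (as.map fun a => qPochInf q a).prod

/-- The kernel `F(z)`. -/
def F (q b c d e z : ℂ) : ℂ :=
  qPochsInf q [c * z / d, c / (d * z), c * z / e, c / (e * z)] /
    qPochsInf q [c * z, c / z, c ^ 2 * z / (b * d * e), c ^ 2 / (b * d * e * z)]

/-- The prefactor `A(z)`. -/
def A (q b c d e z : ℂ) : ℂ :=
  qPochsInf q [c * z / (d * e), c / (d * e * z)] /
    qPochsInf q [c ^ 2 * z / (b * d * e), c ^ 2 / (b * d * e * z)]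

/-- The prefactor `B(z)`. -/
def B (q b c z : ℂ) : ℂ :=
  qPochsInf q [b * z, b / z] / qPochsInf q [c * z, c / z]

/-- The normalized kernel `H = F / A`, as a quotient of products. -/
def H (q c d e z : ℂ) : ℂ :=
  qPochsInf q [c * z / d, c / (d * z), c * z / e, c / (e * z)] /
    qPochsInf q [c * z, c / z, c * z / (d * e), c / (d * e * z)]

/-- The normalized kernel `K = F / B`, as a quotient of products. -/
def K (q b c d e z : ℂ) : ℂ :=
  qPochsInf q [c * z / d, c / (d * z), c * z / e, c / (e * z)] /
    qPochsInf q [b * z, b / z, c ^ 2 * z / (b * d * e), c ^ 2 / (b * d * e * z)]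

/-- The rational basis `Φ_k(z;a,c)`. -/
def Phi (q a c : ℂ) (k : ℕ) (z : ℂ) : ℂ :=
  qPochs q [a * z, a / z] k / qPochs q [c * z, c / z] k

/-- The complementary rational basis `Ψ_k(z;b,c,d,e)`. -/
def Psi (q b c d e : ℂ) (k : ℕ) (z : ℂ) : ℂ :=
  qPochs q [c * z / (d * e), c / (d * e * z)] k /
    qPochs q [c ^ 2 * z / (b * d * e), c ^ 2 / (b * d * e * z)] k

/-- The coefficients `f_k`. -/
def fCoeff (q b c d e : ℂ) (k : ℕ) : ℂ :=
  (1 - b * c * q ^ (2 * (k : ℤ) - 1)) / (1 - b * c * q⁻¹) *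
    (qPochs q [b * c * q⁻¹, d, e, c ^ 2 / (d * e * q)] k /
      qPochs q [q, b * c / d, b * c / e, b * d * e * q / c] k) * q ^ k

/-- The coefficients `g_k`. -/
def gCoeff (q b c d e : ℂ) (k : ℕ) : ℂ :=
  (1 - c ^ 3 * q ^ (2 * (k : ℤ) - 1) / (b * d ^ 2 * e ^ 2)) /
      (1 - c ^ 3 / (b * d ^ 2 * e ^ 2 * q)) *
    (qPochs q [c ^ 3 / (b * d ^ 2 * e ^ 2 * q), c / (b * d), c / (b * e),
        c ^ 2 / (d * e * q)] k /
      qPochs q [q, c ^ 2 / (d * e ^ 2), c ^ 2 / (d ^ 2 * e), c * q / (b * d * e)] k) * q ^ k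

/-- The `k`-th summand of the very-well-poised series `W(a; b₁,…,b_m; q, x)`, that is
`(1 - a q^{2k})/(1 - a) · (a,b₁,…,b_m;q)_k / (q,aq/b₁,…,aq/b_m;q)_k · x^k`.
For `m = 5` the series is `₈W₇`. -/
def wTerm (q a : ℂ) (bs : List ℂ) (x : ℂ) (k : ℕ) : ℂ :=
  (1 - a * q ^ (2 * k)) / (1 - a) *
    (qPochs q (a :: bs) k / qPochs q (q :: bs.map fun b => a * q / b) k) * x ^ k

/-- The pole set `{c q^m, (c q^m)⁻¹ : m ≥ 0}` of `Φ_k(·;a,c)`, `k ≥ 0`. -/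
def poles (q c : ℂ) : Set ℂ := {z | ∃ m : ℕ, z = c * q ^ m ∨ z = (c * q ^ m)⁻¹}

/-- The points of `ℂ*` off the pole sets of both bases. -/
def admissible (q b c d e : ℂ) : Set ℂ :=
  {z | z ≠ 0 ∧ z ∉ poles q c ∧ z ∉ poles q (c ^ 2 / (b * d * e))}

/-- Genericity of the parameters: no parameter by which one divides is zero, and the denominators
of `H(b)`, `K(c/de)`, `f_k` and `g_k` do not vanish. -/
structure Generic (q b c d e : ℂ) : Prop where
  b_ne : b ≠ 0
  c_ne : c ≠ 0
  d_ne : d ≠ 0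
  e_ne : e ≠ 0
  H_den : qPochsInf q [b * c, c / b, b * c / (d * e), c / (b * d * e)] ≠ 0
  K_den : qPochsInf q [b * c / (d * e), b * d * e / c, c ^ 3 / (b * d ^ 2 * e ^ 2), c / b] ≠ 0
  f_den : 1 - b * c * q⁻¹ ≠ 0
  f_den' : ∀ k : ℕ, qPochs q [q, b * c / d, b * c / e, b * d * e * q / c] k ≠ 0
  g_den : 1 - c ^ 3 / (b * d ^ 2 * e ^ 2 * q) ≠ 0
  g_den' : ∀ k : ℕ,
    qPochs q [q, c ^ 2 / (d * e ^ 2), c ^ 2 / (d ^ 2 * e), c * q / (b * d * e)] k ≠ 0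

end TwoBasis

end

open TwoBasis

/-!
Multiply each of the two very-well-poised series by the denominators of its terms, which makes it
an entire function of the parameters, and let `G(r; c, d, e, f)` be the difference of the two
regularised series with their prefactors. The substitution `r ↦ r⁻¹`,
`(c, d, e, f) ↦ (c, d, e, f) / r` swaps them.
A contiguous relation, obtained by telescoping, expresses each regularised series at `c` through
the same series at `c q`; the boundary terms cancel in `G`, which therefore satisfies a first-order
`q`-difference equation in each of `c, d, e, f`. Iterating it, continuity at `0` makes `G` an
infinite product times `G(r; 0, 0, 0, 0)`, and this constant is read off at `(1, 0, 0, 0)`, where a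
single term survives. The kernel identity is the case `r = bde / c` of `G(r; d, e, bz, b / z)`.
The regularised terms are moreover bounded by a geometric sequence, uniformly for `z` in a compact
set of admissible points, which yields uniform convergence.
-/

noncomputable section

namespace TwoBasis

open Filter Topology

section Pochhammer

variable {q : ℂ}

lemma qPoch_zero (q x : ℂ) : qPoch q x 0 = 1 := by simp [qPoch]

lemma qPoch_succ (q x : ℂ) (k : ℕ) : qPoch q x (k + 1) = qPoch q x k * (1 - x * q ^ k) := by
  simp [qPoch, Finset.prod_range_succ]

lemma qPoch_succ_left (q x : ℂ) (k : ℕ) :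
    qPoch q x (k + 1) = (1 - x) * qPoch q (x * q) k := by
  simp only [qPoch, Finset.prod_range_succ', pow_zero, mul_one]
  rw [mul_comm]
  congr 1
  exact Finset.prod_congr rfl fun j _ => by ring

lemma continuous_qPoch (q : ℂ) (k : ℕ) : Continuous fun x => qPoch q x k := by
  unfold qPoch
  fun_prop

lemma summable_norm_mul_pow (hq : ‖q‖ < 1) (x : ℂ) : Summable fun j : ℕ => ‖-(x * q ^ j)‖ := by
  simpa using (summable_geometric_of_lt_one (norm_nonneg q) hq).mul_left ‖x‖

lemma tendsto_qPoch (hq : ‖q‖ < 1) (x : ℂ) :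
    Tendsto (qPoch q x) atTop (𝓝 (qPochInf q x)) := by
  have h : Multipliable fun j : ℕ => 1 - x * q ^ j := by
    simpa [sub_eq_add_neg] using multipliable_one_add_of_summable (summable_norm_mul_pow hq x)
  exact h.hasProd.tendsto_prod_nat

lemma qPochInf_eq_one_sub_mul (hq : ‖q‖ < 1) (x : ℂ) :
    qPochInf q x = (1 - x) * qPochInf q (x * q) := by
  refine tendsto_nhds_unique ((tendsto_qPoch hq x).comp (tendsto_add_atTop_nat 1)) ?_
  refine ((tendsto_qPoch hq (x * q)).const_mul (1 - x)).congr fun k => ?_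
  simp [qPoch_succ_left]

lemma qPochInf_eq_qPoch_mul (hq : ‖q‖ < 1) (x : ℂ) (k : ℕ) :
    qPochInf q x = qPoch q x k * qPochInf q (x * q ^ k) := by
  induction k with
  | zero => simp [qPoch_zero]
  | succ k ih =>
    rw [ih, qPochInf_eq_one_sub_mul hq (x * q ^ k), qPoch_succ]
    ring_nf

lemma qPochInf_zero (q : ℂ) : qPochInf q 0 = 1 := by simp [qPochInf]

lemma qPochInf_one (hq : ‖q‖ < 1) : qPochInf q 1 = 0 := by simp [qPochInf_eq_one_sub_mul hq 1]

lemma qPochInf_ne_zero (hq : ‖q‖ < 1) {x : ℂ} (h : ∀ j : ℕ, 1 - x * q ^ j ≠ 0) :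
    qPochInf q x ≠ 0 := by
  have := tprod_one_add_ne_zero_of_summable (f := fun j : ℕ => -(x * q ^ j))
    (fun j => by simpa [sub_eq_add_neg] using h j) (summable_norm_mul_pow hq x)
  simpa [qPochInf, sub_eq_add_neg] using this

lemma qPochInf_ne_zero_of_qPoch (hq : ‖q‖ < 1) {x : ℂ} (h : ∀ k : ℕ, qPoch q x k ≠ 0) :
    qPochInf q x ≠ 0 :=
  qPochInf_ne_zero hq fun j => right_ne_zero_of_mul (qPoch_succ q x j ▸ h (j + 1))

lemma qPochInf_div_self (hq : ‖q‖ < 1) (hq0 : q ≠ 0) (x : ℂ) :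
    qPochInf q (x / q) = (1 - x / q) * qPochInf q x := by
  rw [qPochInf_eq_one_sub_mul hq, div_mul_cancel₀ _ hq0]

lemma qPochInf_theta_inversion (hq : ‖q‖ < 1) {x : ℂ} (hx : x ≠ 0) :
    qPochInf q x⁻¹ * qPochInf q (x * q) = -(x⁻¹ * (qPochInf q x * qPochInf q (q / x))) := by
  rw [qPochInf_eq_one_sub_mul hq x, qPochInf_eq_one_sub_mul hq x⁻¹, inv_mul_eq_div]
  field_simp
  ring

lemma continuous_qPochInf (hq : ‖q‖ < 1) : Continuous (qPochInf q) := by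
  rw [continuous_iff_continuousAt]
  intro x
  have hs : Summable fun j : ℕ => (‖x‖ + 1) * ‖q‖ ^ j :=
    (summable_geometric_of_lt_one (norm_nonneg q) hq).mul_left _
  have := tendsto_tprod_one_add_of_dominated_convergence (𝓕 := 𝓝 x)
    (f := fun (y : ℂ) (j : ℕ) => -(y * q ^ j)) (g := fun j : ℕ => -(x * q ^ j)) hs
    (fun j => Continuous.tendsto (by fun_prop) x) ?_
  · simp only [← sub_eq_add_neg] at this
    exact this
  · filter_upwards [Metric.ball_mem_nhds x one_pos] with y hy j
    rw [norm_neg, norm_mul, norm_pow]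
    gcongr
    have h1 : ‖y - x‖ < 1 := by simpa [dist_eq_norm] using hy
    linarith [norm_le_norm_add_norm_sub' y x]

lemma norm_qPoch_le (hq : ‖q‖ < 1) (x : ℂ) (k : ℕ) :
    ‖qPoch q x k‖ ≤ Real.exp (‖x‖ / (1 - ‖q‖)) := by
  have hsum : ∑ j ∈ Finset.range k, ‖-(x * q ^ j)‖ ≤ ‖x‖ / (1 - ‖q‖) := by
    refine ((summable_norm_mul_pow hq x).sum_le_tsum _ fun _ _ => norm_nonneg _).trans_eq ?_
    simp only [norm_neg, norm_mul, norm_pow]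
    rw [tsum_mul_left, tsum_geometric_of_lt_one (norm_nonneg q) hq, div_eq_mul_inv]
  have hsub := Finset.norm_prod_one_add_sub_one_le (Finset.range k) fun j : ℕ => -(x * q ^ j)
  have htri := norm_le_norm_sub_add (∏ j ∈ Finset.range k, (1 + -(x * q ^ j))) 1
  simp only [norm_one] at htri
  simp only [qPoch, sub_eq_add_neg] at *
  linarith [Real.exp_le_exp.2 hsum]

end Pochhammer

section PochhammerLists

variable {q : ℂ}

lemma qPochs_cons (q b : ℂ) (bs : List ℂ) (k : ℕ) :
    qPochs q (b :: bs) k = qPoch q b k * qPochs q bs k := by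
  simp [qPochs]

lemma qPochsInf_cons (q b : ℂ) (bs : List ℂ) :
    qPochsInf q (b :: bs) = qPochInf q b * qPochsInf q bs := by
  simp [qPochsInf]

lemma qPochs_perm {bs bs' : List ℂ} (h : bs.Perm bs') (q : ℂ) (k : ℕ) :
    qPochs q bs k = qPochs q bs' k :=
  (h.map _).prod_eq

lemma qPochsInf_perm {bs bs' : List ℂ} (h : bs.Perm bs') (q : ℂ) :
    qPochsInf q bs = qPochsInf q bs' :=
  (h.map _).prod_eq

lemma qPochs_zero (q : ℂ) (bs : List ℂ) : qPochs q bs 0 = 1 := by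
  simp [qPochs, qPoch_zero]

lemma qPochs_succ (q : ℂ) (bs : List ℂ) (k : ℕ) :
    qPochs q bs (k + 1) = qPochs q bs k * (bs.map fun b => 1 - b * q ^ k).prod := by
  simp only [qPochs, qPoch_succ, List.prod_map_mul]

lemma qPochsInf_eq_qPochs_mul (hq : ‖q‖ < 1) (bs : List ℂ) (k : ℕ) :
    qPochsInf q bs = qPochs q bs k * qPochsInf q (bs.map (· * q ^ k)) := by
  simp only [qPochs, qPochsInf, List.map_map, ← List.prod_map_mul]
  exact congrArg List.prod (List.map_congr_left fun b _ => qPochInf_eq_qPoch_mul hq b k)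

lemma tendsto_qPochs (hq : ‖q‖ < 1) (bs : List ℂ) :
    Tendsto (qPochs q bs) atTop (𝓝 (qPochsInf q bs)) :=
  tendsto_list_prod bs fun b _ => tendsto_qPoch hq b

lemma continuous_qPochs {X : Type*} [TopologicalSpace X] (q : ℂ) {bs : List (X → ℂ)}
    (hbs : ∀ b ∈ bs, Continuous b) (k : ℕ) :
    Continuous fun x => qPochs q (bs.map (· x)) k := by
  simp only [qPochs, List.map_map]
  exact continuous_list_prod bs fun b hb => (continuous_qPoch q k).comp (hbs b hb)

lemma continuousOn_qPochsInf {X : Type*} [TopologicalSpace X] {s : Set X} (hq : ‖q‖ < 1)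
    {bs : List (X → ℂ)} (hbs : ∀ b ∈ bs, ContinuousOn b s) :
    ContinuousOn (fun x => qPochsInf q (bs.map (· x))) s := by
  simp only [qPochsInf, List.map_map]
  exact continuousOn_list_prod bs fun b hb => (continuous_qPochInf hq).comp_continuousOn (hbs b hb)

lemma norm_qPochs_le (hq : ‖q‖ < 1) (bs : List ℂ) (k : ℕ) :
    ‖qPochs q bs k‖ ≤ Real.exp ((bs.map norm).sum / (1 - ‖q‖)) := by
  induction bs with
  | nil => simp [qPochs]
  | cons b bs ih =>
    rw [qPochs_cons, norm_mul, List.map_cons, List.sum_cons, add_div, Real.exp_add]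
    gcongr
    exact norm_qPoch_le hq b k

lemma norm_qPochsInf_le (hq : ‖q‖ < 1) (bs : List ℂ) :
    ‖qPochsInf q bs‖ ≤ Real.exp ((bs.map norm).sum / (1 - ‖q‖)) :=
  le_of_tendsto (tendsto_qPochs hq bs).norm (Eventually.of_forall (norm_qPochs_le hq bs))

/-- Iterating the functional equation pushes the argument of `f` to `0`. -/
lemma eq_qPochsInf_mul_of_functional_eq (hq : ‖q‖ < 1) {f : ℂ → ℂ} {bs : List ℂ}
    (hf : ContinuousAt f 0) (h : ∀ x, f x = (bs.map fun b => 1 - b * x).prod * f (x * q)) (x : ℂ) :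
    f x = qPochsInf q (bs.map (· * x)) * f 0 := by
  have iterate (n : ℕ) : f x = qPochs q (bs.map (· * x)) n * f (x * q ^ n) := by
    induction n with
    | zero => simp [qPochs_zero]
    | succ n ih =>
      rw [ih, h (x * q ^ n), qPochs_succ, List.map_map, pow_succ, mul_assoc, mul_assoc]
      simp only [Function.comp_def, mul_assoc]
  have hx : Tendsto (fun n : ℕ => x * q ^ n) atTop (𝓝 0) := by
    simpa using (tendsto_pow_atTop_nhds_zero_of_norm_lt_one hq).const_mul x
  exact tendsto_nhds_unique (tendsto_const_nhds.congr iterate)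
    ((tendsto_qPochs hq _).mul (hf.tendsto.comp hx))

end PochhammerLists

section RegularizedTerm

variable {q : ℂ}

/-- The `k`-th term of a very-well-poised series with argument `q`, numerator parameters `a, bs`
and denominator parameters `q, cs`, multiplied by `(1 - a) (q, cs; q)_∞`. This clears all
denominators, so the term is an entire function of `a`, `bs` and `cs`. -/
def regTerm (q a : ℂ) (bs cs : List ℂ) (k : ℕ) : ℂ :=
  (1 - a * q ^ (2 * k)) * qPochs q (a :: bs) k * qPochsInf q ((q :: cs).map (· * q ^ k)) * q ^ k

lemma regTerm_perm {bs bs' cs cs' : List ℂ} (hb : bs.Perm bs') (hc : cs.Perm cs') (q a : ℂ) :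
    regTerm q a bs cs = regTerm q a bs' cs' := by
  ext k
  rw [regTerm, regTerm, qPochs_perm (hb.cons a), qPochsInf_perm ((hc.cons q).map _)]

/-- The constant in the geometric bound for `regTerm`. -/
def regTermBound (q a : ℂ) (bs cs : List ℂ) : ℝ :=
  (1 + ‖a‖) * Real.exp (((a :: bs ++ q :: cs).map norm).sum / (1 - ‖q‖))

lemma norm_regTerm_le (hq : ‖q‖ < 1) (a : ℂ) (bs cs : List ℂ) (k : ℕ) :
    ‖regTerm q a bs cs k‖ ≤ regTermBound q a bs cs * ‖q‖ ^ k := by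
  have norm_mul_pow_le (x : ℂ) (n : ℕ) : ‖x * q ^ n‖ ≤ ‖x‖ := by
    rw [norm_mul, norm_pow]
    exact mul_le_of_le_one_right (norm_nonneg x) (pow_le_one₀ (norm_nonneg q) hq.le)
  have hfactor : ‖1 - a * q ^ (2 * k)‖ ≤ 1 + ‖a‖ := by
    refine (norm_sub_le _ _).trans ?_
    rw [norm_one]
    gcongr
    exact norm_mul_pow_le a _
  have hden : ‖qPochsInf q ((q :: cs).map (· * q ^ k))‖ ≤
      Real.exp (((q :: cs).map norm).sum / (1 - ‖q‖)) := by
    refine (norm_qPochsInf_le hq _).trans (Real.exp_le_exp.2 ?_)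
    have := sub_pos.2 hq
    rw [List.map_map]
    gcongr
    exact List.sum_le_sum fun x _ => norm_mul_pow_le x k
  rw [regTerm, regTermBound, List.map_append, List.sum_append, add_div, Real.exp_add, ← mul_assoc,
    norm_mul, norm_mul, norm_mul, norm_pow]
  gcongr
  exact norm_qPochs_le hq _ k

lemma summable_of_norm_le_mul_pow (hq : ‖q‖ < 1) {u : ℕ → ℂ} {C : ℝ}
    (h : ∀ k, ‖u k‖ ≤ C * ‖q‖ ^ k) : Summable u :=
  .of_norm_bounded ((summable_geometric_of_lt_one (norm_nonneg q) hq).mul_left C) h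

lemma summable_regTerm (hq : ‖q‖ < 1) (a : ℂ) (bs cs : List ℂ) : Summable (regTerm q a bs cs) :=
  summable_of_norm_le_mul_pow hq (norm_regTerm_le hq a bs cs)

variable {X : Type*} [TopologicalSpace X] {s : Set X} {a : X → ℂ} {bs cs : List (X → ℂ)}

lemma continuousOn_regTermBound (q : ℂ) (ha : ContinuousOn a s)
    (hbs : ∀ b ∈ bs, ContinuousOn b s) (hcs : ∀ c ∈ cs, ContinuousOn c s) :
    ContinuousOn (fun x => regTermBound q (a x) (bs.map (· x)) (cs.map (· x))) s := by
  have sum_norm {l : List (X → ℂ)} (hl : ∀ f ∈ l, ContinuousOn f s) :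
      ContinuousOn (fun x => ((l.map (· x)).map norm).sum) s := by
    simp only [List.map_map]
    exact continuousOn_list_sum l fun f hf => (hl f hf).norm
  simp only [regTermBound, List.map_append, List.map_cons, List.sum_append, List.sum_cons]
  have := sum_norm hbs
  have := sum_norm hcs
  fun_prop

lemma continuous_tsum_regTerm (hq : ‖q‖ < 1) (ha : Continuous a) (hbs : ∀ b ∈ bs, Continuous b)
    (hcs : ∀ c ∈ cs, Continuous c) :
    Continuous fun x => ∑' k, regTerm q (a x) (bs.map (· x)) (cs.map (· x)) k := by
  have hbound : Continuous fun x => regTermBound q (a x) (bs.map (· x)) (cs.map (· x)) := by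
    simp only [← continuousOn_univ] at *
    exact continuousOn_regTermBound q ha hbs hcs
  have hterm (k : ℕ) : Continuous fun x => regTerm q (a x) (bs.map (· x)) (cs.map (· x)) k := by
    have hnum : Continuous fun x => qPochs q (bs.map (· x)) k := continuous_qPochs q hbs k
    have hden : Continuous fun x => qPochsInf q ((cs.map (· x)).map (· * q ^ k)) := by
      simp only [qPochsInf, List.map_map]
      exact continuous_list_prod cs fun c hc =>
        (continuous_qPochInf hq).comp ((hcs c hc).mul_const _)
    have := continuous_qPoch q k
    simp only [regTerm, qPochs_cons, List.map_cons, qPochsInf_cons]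
    fun_prop
  rw [continuous_iff_continuousAt]
  intro x
  refine tendsto_tsum_of_dominated_convergence
    ((summable_geometric_of_lt_one (norm_nonneg q) hq).mul_left
      (regTermBound q (a x) (bs.map (· x)) (cs.map (· x)) + 1))
    (fun k => (hterm k).tendsto x) ?_
  filter_upwards [(hbound.tendsto x).eventually_lt_const (lt_add_one _)] with y hy k
  refine (norm_regTerm_le hq _ _ _ k).trans ?_
  gcongr

end RegularizedTerm

section ContiguousRelation

variable {q : ℂ}

/-- The common factor of the `n`-th and `(n + 1)`-st values of `shiftBoundary`. The index `m`, which
is `n` or `n + 1`, is kept separate so that the finite and the infinite products shift one at a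
time. -/
def shiftFactor (q a b c d e f u v w x y : ℂ) (n m : ℕ) : ℂ :=
  qPochs q [a, d, e, f] (n + 1) * qPochs q [b * q, c * q] n *
    qPochsInf q ([q, u, v * q, w, x * q, y * q].map (· * q ^ m))

lemma qPochsInf_map_mul_pow_eq (hq : ‖q‖ < 1) (bs : List ℂ) (n : ℕ) :
    qPochsInf q (bs.map (· * q ^ n)) =
      (bs.map fun b => 1 - b * q ^ n).prod * qPochsInf q (bs.map (· * q ^ (n + 1))) := by
  rw [qPochsInf_eq_qPochs_mul hq _ 1, qPochs_succ, qPochs_zero, one_mul, List.map_map, List.map_map]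
  simp only [Function.comp_def, pow_zero, pow_succ, mul_one, one_mul, mul_assoc]

lemma shiftFactor_eq (hq : ‖q‖ < 1) (a b c d e f u v w x y : ℂ) (n m : ℕ) :
    shiftFactor q a b c d e f u v w x y n m =
      ((1 - q * q ^ m) * (1 - u * q ^ m) * (1 - v * q * q ^ m) * (1 - w * q ^ m) *
        (1 - x * q * q ^ m) * (1 - y * q * q ^ m)) *
      shiftFactor q a b c d e f u v w x y n (m + 1) := by
  rw [shiftFactor, qPochsInf_map_mul_pow_eq hq _ m, shiftFactor]
  simp only [List.map_cons, List.map_nil, List.prod_cons, List.prod_nil, mul_one]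
  ac_rfl

lemma shiftFactor_succ (q a b c d e f u v w x y : ℂ) (n m : ℕ) :
    shiftFactor q a b c d e f u v w x y (n + 1) m =
      ((1 - a * q ^ (n + 1)) * (1 - b * q * q ^ n) * (1 - c * q * q ^ n) *
        (1 - d * q ^ (n + 1)) * (1 - e * q ^ (n + 1)) * (1 - f * q ^ (n + 1))) *
      shiftFactor q a b c d e f u v w x y n m := by
  rw [shiftFactor, qPochs_succ q [a, d, e, f] (n + 1), qPochs_succ q [b * q, c * q] n, shiftFactor]
  simp only [List.map_cons, List.map_nil, List.prod_cons, List.prod_nil, mul_one]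
  ac_rfl

lemma regTerm_succ_eq_shiftFactor (hq : ‖q‖ < 1) (a b c d e f u v w x y : ℂ) (n : ℕ) :
    regTerm q a [c, d, b, e, f] [u, v, w, x, y] (n + 1) =
      (1 - a * q ^ (2 * (n + 1))) * q ^ (n + 1) * (1 - b) * (1 - c) *
        ((1 - v * q ^ (n + 1)) * (1 - x * q ^ (n + 1)) * (1 - y * q ^ (n + 1))) *
        shiftFactor q a b c d e f u v w x y n (n + 1) := by
  have tail (z : ℂ) : qPochInf q (z * q ^ (n + 1)) =
      (1 - z * q ^ (n + 1)) * qPochInf q (z * q * q ^ (n + 1)) := by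
    rw [qPochInf_eq_one_sub_mul hq, mul_right_comm]
  simp only [regTerm, shiftFactor, qPochs_cons, List.map_cons, qPochsInf_cons,
    qPoch_succ_left q b, qPoch_succ_left q c, tail v, tail x, tail y]
  simp only [qPochs, qPochsInf, List.map_nil, List.prod_nil, mul_one]
  ac_rfl

lemma one_sub_mul_regTerm_mul (q a : ℂ) (bs cs : List ℂ) (k : ℕ) :
    (1 - a) * regTerm q (a * q) bs cs k =
      (1 - a * q * q ^ (2 * k)) * (1 - a * q ^ k) * qPochs q (a :: bs) k *
        qPochsInf q ((q :: cs).map (· * q ^ k)) * q ^ k := by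
  have head : (1 - a) * qPoch q (a * q) k = qPoch q a k * (1 - a * q ^ k) := by
    rw [← qPoch_succ_left, qPoch_succ]
  rw [regTerm, qPochs_cons, qPochs_cons]
  linear_combination (1 - a * q * q ^ (2 * k)) * qPochs q bs k *
    qPochsInf q ((q :: cs).map (· * q ^ k)) * q ^ k * head

lemma regTerm_mul_succ_eq_shiftFactor (q a b c d e f u v w x y : ℂ) (n : ℕ) :
    (1 - a) * regTerm q (a * q) [c * q, d, b * q, e, f] [u, v * q, w, x * q, y * q] (n + 1) =
      (1 - a * q * q ^ (2 * (n + 1))) * q ^ (n + 1) *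
        ((1 - a * q ^ (n + 1)) * (1 - b * q * q ^ n) * (1 - c * q * q ^ n)) *
        shiftFactor q a b c d e f u v w x y n (n + 1) := by
  simp only [one_sub_mul_regTerm_mul, shiftFactor, qPochs_cons, qPoch_succ q (b * q),
    qPoch_succ q (c * q)]
  simp only [qPochs, List.map_nil, List.prod_nil, mul_one]
  ac_rfl

end ContiguousRelation

section BaileySeries

variable {q r : ℂ}

/-- The terms of the very-well-poised series with numerator parameters `a, c, d, b, e, f`, where
`a = cdef/(qr)` and `b = a/r`, so that `a²q = bcdef`. Unlike in the usual parameters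
`(a; b, c, d, e, f)`, everything is polynomial in `c, d, e, f`, which may therefore vanish. -/
def baileyTerm (q r c d e f : ℂ) (k : ℕ) : ℂ :=
  regTerm q (c * d * e * f / (r * q)) [c, d, c * d * e * f / (r ^ 2 * q), e, f]
    [d * e * f / r, c * e * f / r, r * q, c * d * f / r, c * d * e / r] k

/-- The telescoping sequence whose increments are the summands in `sum_range_baileyTerm_sub`. -/
def shiftBoundary (q r c d e f : ℂ) (n : ℕ) : ℂ :=
  -(c / r) * (1 - c * (c * d * e * f / (r ^ 2 * q)) * q ^ (n + 1)) *
    shiftFactor q (c * d * e * f / (r * q)) (c * d * e * f / (r ^ 2 * q)) c d e f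
      (d * e * f / r) (c * e * f / r) (r * q) (c * d * f / r) (c * d * e / r) n n

lemma baileyTerm_mul (q r c d e f : ℂ) :
    baileyTerm q r (c * q) d e f =
      regTerm q (c * d * e * f / (r * q) * q)
        [c * q, d, c * d * e * f / (r ^ 2 * q) * q, e, f]
        [d * e * f / r, c * e * f / r * q, r * q, c * d * f / r * q, c * d * e / r * q] := by
  ext k
  rw [baileyTerm]
  ring_nf

lemma telescoping_identity (hq0 : q ≠ 0) (hr : r ≠ 0) (c d e f Q : ℂ) :
    (1 - c / r) * ((1 - c * d * e * f / (r * q) * Q ^ 2) * Q *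
        (1 - c * d * e * f / (r ^ 2 * q)) * (1 - c) * ((1 - c * e * f / r * Q) *
        (1 - c * d * f / r * Q) * (1 - c * d * e / r * Q))) -
      (1 - c * d / r) * (1 - c * e / r) * (1 - c * f / r) *
        ((1 - c * d * e * f / (r * q) * q * Q ^ 2) * Q * ((1 - c * d * e * f / (r * q) * Q) *
        (1 - c * d * e * f / (r ^ 2 * q) * Q) * (1 - c * Q))) =
    -(c / r) * ((1 - c * (c * d * e * f / (r ^ 2 * q)) * (Q * q)) *
        ((1 - c * d * e * f / (r * q) * Q) * (1 - c * d * e * f / (r ^ 2 * q) * Q) * (1 - c * Q) *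
        (1 - d * Q) * (1 - e * Q) * (1 - f * Q)) -
      (1 - c * (c * d * e * f / (r ^ 2 * q)) * Q) * ((1 - Q) * (1 - d * e * f / r * (Q / q)) *
        (1 - c * e * f / r * Q) * (1 - r * Q) * (1 - c * d * f / r * Q) *
        (1 - c * d * e / r * Q))) := by
  field_simp
  ring

lemma baileyTerm_succ_sub (hq : ‖q‖ < 1) (hq0 : q ≠ 0) (hr : r ≠ 0) (c d e f : ℂ) (n : ℕ) :
    (1 - c / r) * baileyTerm q r c d e f (n + 1) -
      (1 - c * d * e * f / (r * q)) * (1 - c * d / r) * (1 - c * e / r) * (1 - c * f / r) *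
        baileyTerm q r (c * q) d e f (n + 1) =
      shiftBoundary q r c d e f (n + 1) - shiftBoundary q r c d e f n := by
  have hshift := regTerm_mul_succ_eq_shiftFactor q (c * d * e * f / (r * q))
    (c * d * e * f / (r ^ 2 * q)) c d e f (d * e * f / r) (c * e * f / r) (r * q) (c * d * f / r)
    (c * d * e / r) n
  rw [← baileyTerm_mul] at hshift
  have hid := telescoping_identity hq0 hr c d e f (q ^ (n + 1))
  rw [show q ^ (n + 1) / q = q ^ n by rw [pow_succ, mul_div_cancel_right₀ _ hq0]] at hid
  rw [baileyTerm, regTerm_succ_eq_shiftFactor hq, shiftBoundary, shiftBoundary, shiftFactor_succ,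
    shiftFactor_eq hq _ _ _ _ _ _ _ _ _ _ _ n n]
  linear_combination shiftFactor q (c * d * e * f / (r * q)) (c * d * e * f / (r ^ 2 * q)) c d e f
    (d * e * f / r) (c * e * f / r) (r * q) (c * d * f / r) (c * d * e / r) n (n + 1) * hid -
    (1 - c * d / r) * (1 - c * e / r) * (1 - c * f / r) * hshift

lemma baileyTerm_zero_sub (hq : ‖q‖ < 1) (hq0 : q ≠ 0) (hr : r ≠ 0) (c d e f : ℂ) :
    (1 - c / r) * baileyTerm q r c d e f 0 -
      (1 - c * d * e * f / (r * q)) * (1 - c * d / r) * (1 - c * e / r) * (1 - c * f / r) *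
        baileyTerm q r (c * q) d e f 0 =
      shiftBoundary q r c d e f 0 := by
  have hid : (1 - c / r) *
      ((1 - c * e * f / r) * (1 - c * d * f / r) * (1 - c * d * e / r)) -
      (1 - c * d / r) * (1 - c * e / r) * (1 - c * f / r) * (1 - c * d * e * f / (r * q) * q) =
      -(c / r) * (1 - c * (c * d * e * f / (r ^ 2 * q)) * q) * ((1 - d) * (1 - e) * (1 - f)) := by
    field_simp
    ring
  rw [baileyTerm_mul]
  simp only [baileyTerm, regTerm, shiftBoundary, shiftFactor, qPochs_succ, qPochs_zero,
    qPochsInf, List.map_cons, List.map_nil, List.prod_cons, List.prod_nil,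
    qPochInf_eq_one_sub_mul hq (c * e * f / r), qPochInf_eq_one_sub_mul hq (c * d * f / r),
    qPochInf_eq_one_sub_mul hq (c * d * e / r), pow_zero, mul_one, one_mul, mul_zero, zero_add,
    pow_one]
  linear_combination (1 - c * d * e * f / (r * q)) *
    (qPochInf q q * qPochInf q (d * e * f / r) * qPochInf q (c * e * f / r * q) *
      qPochInf q (r * q) * qPochInf q (c * d * f / r * q) * qPochInf q (c * d * e / r * q)) * hid

lemma sum_range_baileyTerm_sub (hq : ‖q‖ < 1) (hq0 : q ≠ 0) (hr : r ≠ 0) (c d e f : ℂ) (n : ℕ) :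
    ∑ k ∈ Finset.range (n + 1), ((1 - c / r) * baileyTerm q r c d e f k -
      (1 - c * d * e * f / (r * q)) * (1 - c * d / r) * (1 - c * e / r) * (1 - c * f / r) *
        baileyTerm q r (c * q) d e f k) =
      shiftBoundary q r c d e f n := by
  induction n with
  | zero => rw [Finset.sum_range_one, baileyTerm_zero_sub hq hq0 hr]
  | succ n ih => rw [Finset.sum_range_succ, ih, baileyTerm_succ_sub hq hq0 hr, add_sub_cancel]

end BaileySeries

section BaileyIdentity

variable {q r : ℂ}

lemma tendsto_qPochsInf_map_mul_pow (hq : ‖q‖ < 1) (bs : List ℂ) :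
    Tendsto (fun n : ℕ => qPochsInf q (bs.map (· * q ^ n))) atTop (𝓝 1) := by
  have factor (b : ℂ) : Tendsto (fun n : ℕ => qPochInf q (b * q ^ n)) atTop (𝓝 1) := by
    have h := (tendsto_pow_atTop_nhds_zero_of_norm_lt_one hq).const_mul b
    rw [mul_zero] at h
    simpa only [qPochInf_zero, Function.comp_def] using ((continuous_qPochInf hq).tendsto 0).comp h
  have h := tendsto_list_prod bs fun b _ => factor b
  simpa [qPochsInf, Function.comp_def] using h

lemma tendsto_shiftBoundary (hq : ‖q‖ < 1) (r c d e f : ℂ) :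
    Tendsto (shiftBoundary q r c d e f) atTop (𝓝 (-(c / r) *
      (qPochsInf q [c * d * e * f / (r * q), d, e, f] *
        qPochsInf q [c * d * e * f / (r ^ 2 * q) * q, c * q]))) := by
  have hpow := (tendsto_pow_atTop_nhds_zero_of_norm_lt_one hq).comp (tendsto_add_atTop_nat 1)
  have hnum := (tendsto_qPochs hq [c * d * e * f / (r * q), d, e, f]).comp
    (tendsto_add_atTop_nat 1)
  have hfactor := ((hpow.const_mul (c * (c * d * e * f / (r ^ 2 * q)))).const_sub 1).const_mul
    (-(c / r))
  have := hfactor.mul ((hnum.mul (tendsto_qPochs hq [c * d * e * f / (r ^ 2 * q) * q, c * q])).mul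
    (tendsto_qPochsInf_map_mul_pow hq
      [q, d * e * f / r, c * e * f / r * q, r * q, c * d * f / r * q, c * d * e / r * q]))
  simp only [mul_zero, sub_zero, mul_one] at this
  exact this

/-- The sum of `baileyTerm`. -/
def baileySeries (q r c d e f : ℂ) : ℂ := ∑' k, baileyTerm q r c d e f k

lemma baileySeries_shift (hq : ‖q‖ < 1) (hq0 : q ≠ 0) (hr : r ≠ 0) (c d e f : ℂ) :
    (1 - c / r) * baileySeries q r c d e f -
      (1 - c * d * e * f / (r * q)) * (1 - c * d / r) * (1 - c * e / r) * (1 - c * f / r) *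
        baileySeries q r (c * q) d e f =
      -(c / r) * (qPochsInf q [c * d * e * f / (r * q), d, e, f] *
        qPochsInf q [c * d * e * f / (r ^ 2 * q) * q, c * q]) := by
  have hsum (c : ℂ) : HasSum (baileyTerm q r c d e f) (baileySeries q r c d e f) :=
    (summable_regTerm hq _ _ _).hasSum
  have hpartial := ((hsum c).mul_left (1 - c / r)).sub ((hsum (c * q)).mul_left
    ((1 - c * d * e * f / (r * q)) * (1 - c * d / r) * (1 - c * e / r) * (1 - c * f / r)))
  refine tendsto_nhds_unique (hpartial.tendsto_sum_nat.comp (tendsto_add_atTop_nat 1)) ?_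
  exact (tendsto_shiftBoundary hq r c d e f).congr fun n =>
    (sum_range_baileyTerm_sub hq hq0 hr c d e f n).symm

/-- `baileySeries` with the prefactor it carries in Bailey's nonterminating `₈φ₇` summation. -/
def baileySum (q r c d e f : ℂ) : ℂ :=
  qPochsInf q [c * d * e * f / (r ^ 3 * q), c / r, d / r, e / r, f / r] *
    baileySeries q r c d e f

/-- The left-hand side of Bailey's nonterminating `₈φ₇` summation, with denominators cleared. The
two series are exchanged by the involution `(r; c, d, e, f) ↦ (1/r; c/r, d/r, e/r, f/r)`. -/
def baileyDiff (q r c d e f : ℂ) : ℂ :=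
  baileySum q r c d e f - r⁻¹ * baileySum q r⁻¹ (c / r) (d / r) (e / r) (f / r)

lemma baileySum_shift (hq : ‖q‖ < 1) (hq0 : q ≠ 0) (hr : r ≠ 0) (c d e f : ℂ) :
    baileySum q r c d e f -
      (1 - c * d * e * f / (r * q)) * (1 - c * d * e * f / (r ^ 3 * q)) *
        (1 - c * d / r) * (1 - c * e / r) * (1 - c * f / r) * baileySum q r (c * q) d e f =
      -(c / r) * (qPochsInf q [c * d * e * f / (r * q), c * d * e * f / (r ^ 3 * q),
        c * d * e * f / r ^ 2] * qPochsInf q [c * q, d, e, f] *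
        qPochsInf q [c / r * q, d / r, e / r, f / r]) := by
  have h := baileySeries_shift hq hq0 hr c d e f
  have hprefactor : c * q * d * e * f / (r ^ 3 * q) = c * d * e * f / (r ^ 3 * q) * q := by ring
  have hdiv : c * q / r = c / r * q := by ring
  have hboundary : c * d * e * f / (r ^ 2 * q) * q = c * d * e * f / r ^ 2 := by field_simp
  rw [hboundary] at h
  rw [baileySum, baileySum, hprefactor, hdiv]
  simp only [qPochsInf, List.map_cons, List.map_nil, List.prod_cons, List.prod_nil,
    qPochInf_eq_one_sub_mul hq (c * d * e * f / (r ^ 3 * q)),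
    qPochInf_eq_one_sub_mul hq (c / r)] at h ⊢
  linear_combination (1 - c * d * e * f / (r ^ 3 * q)) *
    (qPochInf q (c * d * e * f / (r ^ 3 * q) * q) * qPochInf q (c / r * q) * qPochInf q (d / r) *
      qPochInf q (e / r) * qPochInf q (f / r)) * h

/-- The boundary term of `baileySum_shift` is multiplied by `r` under the involution that exchanges
the two series, so it cancels in the difference. -/
lemma baileyDiff_shift (hq : ‖q‖ < 1) (hq0 : q ≠ 0) (hr : r ≠ 0) (c d e f : ℂ) :
    baileyDiff q r c d e f =
      (1 - c * d * e * f / (r * q)) * (1 - c * d * e * f / (r ^ 3 * q)) *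
        (1 - c * d / r) * (1 - c * e / r) * (1 - c * f / r) * baileyDiff q r (c * q) d e f := by
  have h := baileySum_shift hq hq0 hr c d e f
  have h' := baileySum_shift hq hq0 (inv_ne_zero hr) (c / r) (d / r) (e / r) (f / r)
  have hleading :
      c / r * (d / r) * (e / r) * (f / r) / (r⁻¹ * q) = c * d * e * f / (r ^ 3 * q) := by
    field_simp
  have hprefactor :
      c / r * (d / r) * (e / r) * (f / r) / (r⁻¹ ^ 3 * q) = c * d * e * f / (r * q) := by
    field_simp
  have hboundary : c / r * (d / r) * (e / r) * (f / r) / r⁻¹ ^ 2 = c * d * e * f / r ^ 2 := by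
    field_simp
  have hdiv (x y : ℂ) : x / r * (y / r) / r⁻¹ = x * y / r := by field_simp
  have hcancel (x : ℂ) : x / r / r⁻¹ = x := by field_simp
  have hmul : c / r * q = c * q / r := by ring
  rw [hleading, hprefactor, hboundary] at h'
  simp only [hdiv, hcancel] at h'
  rw [hmul] at h h'
  simp only [baileyDiff, qPochsInf, List.map_cons, List.map_nil, List.prod_cons, List.prod_nil]
    at h h' ⊢
  linear_combination h - r⁻¹ * h'

end BaileyIdentity

section BaileyProduct

variable {q r : ℂ}

lemma baileyTerm_rotate (q r c d e f : ℂ) : baileyTerm q r c d e f = baileyTerm q r d e f c := by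
  ext k
  simp only [baileyTerm, regTerm, qPochs, qPochsInf, List.map_cons, List.map_nil, List.prod_cons,
    List.prod_nil]
  ring_nf

lemma baileySum_rotate (q r c d e f : ℂ) : baileySum q r c d e f = baileySum q r d e f c := by
  rw [baileySum, baileySum, baileySeries, baileySeries, baileyTerm_rotate]
  simp only [qPochsInf, List.map_cons, List.map_nil, List.prod_cons, List.prod_nil]
  ring_nf

lemma baileyDiff_rotate (q r c d e f : ℂ) : baileyDiff q r c d e f = baileyDiff q r d e f c := by
  rw [baileyDiff, baileyDiff, baileySum_rotate, baileySum_rotate q r⁻¹]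

lemma continuous_baileySum (hq : ‖q‖ < 1) (r d e f : ℂ) :
    Continuous fun c => baileySum q r c d e f := by
  refine Continuous.mul ?_ ?_
  · rw [← continuousOn_univ]
    refine continuousOn_qPochsInf hq (bs := [fun c => c * d * e * f / (r ^ 3 * q), fun c => c / r,
      fun _ => d / r, fun _ => e / r, fun _ => f / r]) ?_
    simp only [List.forall_mem_cons, List.not_mem_nil, false_imp_iff, implies_true, and_true]
    refine ⟨?_, ?_, ?_, ?_, ?_⟩ <;> fun_prop
  · refine continuous_tsum_regTerm hq (a := fun c => c * d * e * f / (r * q))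
      (bs := [fun c => c, fun _ => d, fun c => c * d * e * f / (r ^ 2 * q), fun _ => e, fun _ => f])
      (cs := [fun _ => d * e * f / r, fun c => c * e * f / r, fun _ => r * q,
        fun c => c * d * f / r, fun c => c * d * e / r]) (by fun_prop) ?_ ?_ <;>
    · simp only [List.forall_mem_cons, List.not_mem_nil, false_imp_iff, implies_true, and_true]
      refine ⟨?_, ?_, ?_, ?_, ?_⟩ <;> fun_prop

lemma continuous_baileyDiff (hq : ‖q‖ < 1) (r d e f : ℂ) :
    Continuous fun c => baileyDiff q r c d e f :=
  (continuous_baileySum hq r d e f).sub <| continuous_const.mul <|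
    (continuous_baileySum hq r⁻¹ _ _ _).comp (continuous_id.div_const r)

lemma baileyDiff_eq_mul_zero (hq : ‖q‖ < 1) (hq0 : q ≠ 0) (hr : r ≠ 0) (c d e f : ℂ) :
    baileyDiff q r c d e f =
      qPochsInf q [c * d * e * f / (r * q), c * d * e * f / (r ^ 3 * q), c * d / r, c * e / r,
        c * f / r] * baileyDiff q r 0 d e f := by
  have h := eq_qPochsInf_mul_of_functional_eq hq (f := fun c => baileyDiff q r c d e f)
    (bs := [d * e * f / (r * q), d * e * f / (r ^ 3 * q), d / r, e / r, f / r])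
    (continuous_baileyDiff hq r d e f).continuousAt (fun x => ?_) c
  · simp only [List.map_cons, List.map_nil] at h
    rw [h]
    ring_nf
  · rw [baileyDiff_shift hq hq0 hr]
    simp only [List.map_cons, List.map_nil, List.prod_cons, List.prod_nil]
    ring

lemma baileyDiff_eq_mul_baileyDiff_zero (hq : ‖q‖ < 1) (hq0 : q ≠ 0) (hr : r ≠ 0) (c d e f : ℂ) :
    baileyDiff q r c d e f =
      qPochsInf q [c * d * e * f / (r * q), c * d * e * f / (r ^ 3 * q), c * d / r, c * e / r,
        c * f / r, d * e / r, d * f / r, e * f / r] * baileyDiff q r 0 0 0 0 := by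
  rw [baileyDiff_eq_mul_zero hq hq0 hr, baileyDiff_rotate q r 0, baileyDiff_eq_mul_zero hq hq0 hr,
    baileyDiff_rotate q r 0, baileyDiff_eq_mul_zero hq hq0 hr, baileyDiff_rotate q r 0,
    baileyDiff_eq_mul_zero hq hq0 hr]
  simp only [mul_zero, zero_div, qPochsInf, List.map_cons, List.map_nil, List.prod_cons,
    List.prod_nil, qPochInf_zero]
  ring

lemma baileyTerm_one_zero_succ (q r : ℂ) (k : ℕ) : baileyTerm q r 1 0 0 0 (k + 1) = 0 := by
  simp [baileyTerm, regTerm, qPochs_cons, qPoch_succ_left]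

lemma baileyDiff_one_zero (hq : ‖q‖ < 1) (hr : r ≠ 0) :
    baileyDiff q r 1 0 0 0 = qPochsInf q [q, r * q, r⁻¹] := by
  have hfirst : baileySeries q r 1 0 0 0 = qPochsInf q [q, r * q] := by
    rw [baileySeries, tsum_eq_single 0 fun k hk => ?_]
    · simp [baileyTerm, regTerm, qPochs_zero, qPochsInf, qPochInf_zero]
    · obtain ⟨k, rfl⟩ := Nat.exists_eq_succ_of_ne_zero hk
      exact baileyTerm_one_zero_succ q r k
  have hsecond : baileySum q r⁻¹ (1 / r) (0 / r) (0 / r) (0 / r) = 0 := by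
    simp [baileySum, qPochsInf, qPochInf_one hq, hr]
  rw [baileyDiff, hsecond, baileySum, hfirst]
  simp only [mul_zero, zero_div, one_div, sub_zero, qPochsInf, List.map_cons,
    List.map_nil, List.prod_cons, List.prod_nil, qPochInf_zero]
  ring

lemma baileyDiff_zero (hq : ‖q‖ < 1) (hq0 : q ≠ 0) (hr : r ≠ 0) :
    baileyDiff q r 0 0 0 0 = qPochsInf q [q, r * q, r⁻¹] := by
  have h := baileyDiff_eq_mul_zero hq hq0 hr 1 0 0 0
  rw [baileyDiff_one_zero hq hr] at h
  simpa [qPochsInf, qPochInf_zero] using h.symm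

theorem baileyDiff_eq_qPochsInf (hq : ‖q‖ < 1) (hq0 : q ≠ 0) (hr : r ≠ 0) (c d e f : ℂ) :
    baileyDiff q r c d e f =
      qPochsInf q [q, r * q, r⁻¹, c * d * e * f / (r * q), c * d * e * f / (r ^ 3 * q),
        c * d / r, c * e / r, c * f / r, d * e / r, d * f / r, e * f / r] := by
  rw [baileyDiff_eq_mul_baileyDiff_zero hq hq0 hr, baileyDiff_zero hq hq0 hr]
  simp only [qPochsInf, List.map_cons, List.map_nil, List.prod_cons, List.prod_nil]
  ring

end BaileyProduct

section VeryWellPoised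

variable {q : ℂ}

lemma qPochsInf_ne_zero_of_qPochs (hq : ‖q‖ < 1) {bs : List ℂ} (h : ∀ k, qPochs q bs k ≠ 0) :
    qPochsInf q bs ≠ 0 := by
  simp only [qPochs, qPochsInf, ne_eq, List.prod_eq_zero_iff, List.mem_map, not_exists,
    not_and] at h ⊢
  exact fun b hb => qPochInf_ne_zero_of_qPoch hq fun k => h k b hb

lemma wTerm_eq_regTerm_div (hq : ‖q‖ < 1) (a : ℂ) {bs : List ℂ}
    (h : qPochsInf q (q :: bs.map (a * q / ·)) ≠ 0) (k : ℕ) :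
    wTerm q a bs q k = regTerm q a bs (bs.map (a * q / ·)) k /
      ((1 - a) * qPochsInf q (q :: bs.map (a * q / ·))) := by
  have hsplit := qPochsInf_eq_qPochs_mul hq (q :: bs.map (a * q / ·)) k
  rw [hsplit] at h
  have htail := right_ne_zero_of_mul h
  rw [wTerm, regTerm, hsplit, ← mul_assoc (1 - a), mul_right_comm _ (qPochsInf q _) (q ^ k),
    mul_div_mul_right _ _ htail, div_mul_div_comm, div_mul_eq_mul_div, mul_right_comm]

lemma mul_tsum_wTerm (hq : ‖q‖ < 1) {a : ℂ} {bs : List ℂ} (ha : 1 - a ≠ 0)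
    (h : qPochsInf q (q :: bs.map (a * q / ·)) ≠ 0) :
    (1 - a) * qPochsInf q (q :: bs.map (a * q / ·)) * ∑' k, wTerm q a bs q k =
      ∑' k, regTerm q a bs (bs.map (a * q / ·)) k := by
  simp only [wTerm_eq_regTerm_div hq a h, tsum_div_const]
  exact mul_div_cancel₀ _ (mul_ne_zero ha h)

end VeryWellPoised

section KernelSeries

variable {q b c d e z : ℂ}

lemma map_first_denominators (hq : q ≠ 0) (hb : b ≠ 0) (hc : c ≠ 0) (hd : d ≠ 0) (he : e ≠ 0)
    (hz : z ≠ 0) :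
    [d, e, c ^ 2 / (d * e * q), b * z, b / z].map (b * c / q * q / ·) =
      [b * c / d, b * c / e, b * d * e * q / c, c / z, c * z] := by
  simp only [List.map_cons, List.map_nil, List.cons.injEq, and_true]
  refine ⟨?_, ?_, ?_, ?_, ?_⟩ <;> field_simp

lemma map_second_denominators (hq : q ≠ 0) (hb : b ≠ 0) (hc : c ≠ 0) (hd : d ≠ 0) (he : e ≠ 0)
    (hz : z ≠ 0) :
    [c / (b * d), c / (b * e), c ^ 2 / (d * e * q), c * z / (d * e), c / (d * e * z)].map
        (c ^ 3 / (b * d ^ 2 * e ^ 2 * q) * q / ·) =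
      [c ^ 2 / (d * e ^ 2), c ^ 2 / (d ^ 2 * e), c * q / (b * d * e), c ^ 2 / (b * d * e * z),
        c ^ 2 * z / (b * d * e)] := by
  simp only [List.map_cons, List.map_nil, List.cons.injEq, and_true]
  refine ⟨?_, ?_, ?_, ?_, ?_⟩ <;> field_simp

lemma fCoeff_mul_Phi (hq : q ≠ 0) (hb : b ≠ 0) (hc : c ≠ 0) (hd : d ≠ 0) (he : e ≠ 0)
    (hz : z ≠ 0) (k : ℕ) :
    fCoeff q b c d e k * Phi q b c k z =
      wTerm q (b * c / q) [d, e, c ^ 2 / (d * e * q), b * z, b / z] q k := by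
  have hpow : b * c * q ^ (2 * (k : ℤ) - 1) = b * c / q * q ^ (2 * k) := by
    rw [zpow_sub₀ hq, zpow_one]
    norm_cast
    ring
  rw [wTerm, map_first_denominators hq hb hc hd he hz]
  simp only [fCoeff, Phi, qPochs, List.map_cons, List.map_nil, List.prod_cons, List.prod_nil,
    mul_one, hpow, ← div_eq_mul_inv]
  ring

lemma gCoeff_mul_Psi (hq : q ≠ 0) (hb : b ≠ 0) (hc : c ≠ 0) (hd : d ≠ 0) (he : e ≠ 0)
    (hz : z ≠ 0) (k : ℕ) :
    gCoeff q b c d e k * Psi q b c d e k z =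
      wTerm q (c ^ 3 / (b * d ^ 2 * e ^ 2 * q))
        [c / (b * d), c / (b * e), c ^ 2 / (d * e * q), c * z / (d * e), c / (d * e * z)] q k := by
  have hpow : c ^ 3 * q ^ (2 * (k : ℤ) - 1) / (b * d ^ 2 * e ^ 2) =
      c ^ 3 / (b * d ^ 2 * e ^ 2 * q) * q ^ (2 * k) := by
    rw [zpow_sub₀ hq, zpow_one]
    norm_cast
    field_simp
  rw [wTerm, map_second_denominators hq hb hc hd he hz]
  simp only [gCoeff, Psi, qPochs, List.map_cons, List.map_nil, List.prod_cons, List.prod_nil,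
    mul_one, hpow]
  ring

lemma baileyTerm_first (hq : q ≠ 0) (hb : b ≠ 0) (hc : c ≠ 0) (hd : d ≠ 0) (he : e ≠ 0)
    (hz : z ≠ 0) :
    baileyTerm q (b * d * e / c) d e (b * z) (b / z) =
      regTerm q (b * c / q) [d, e, c ^ 2 / (d * e * q), b * z, b / z]
        [b * c / d, b * c / e, b * d * e * q / c, c / z, c * z] := by
  unfold baileyTerm
  funext k
  congr 1
  · field_simp
  · simp only [List.cons.injEq, and_true, true_and]
    field_simp
  · simp only [List.cons.injEq, and_true]
    refine ⟨?_, ?_, ?_, ?_, ?_⟩ <;> field_simp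

lemma baileyTerm_second (hq : q ≠ 0) (hb : b ≠ 0) (hc : c ≠ 0) (hd : d ≠ 0) (he : e ≠ 0)
    (hz : z ≠ 0) :
    baileyTerm q (b * d * e / c)⁻¹ (d / (b * d * e / c)) (e / (b * d * e / c))
        (b * z / (b * d * e / c)) (b / z / (b * d * e / c)) =
      regTerm q (c ^ 3 / (b * d ^ 2 * e ^ 2 * q))
        [c / (b * d), c / (b * e), c ^ 2 / (d * e * q), c * z / (d * e), c / (d * e * z)]
        [c ^ 2 / (d * e ^ 2), c ^ 2 / (d ^ 2 * e), c * q / (b * d * e), c ^ 2 / (b * d * e * z),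
          c ^ 2 * z / (b * d * e)] := by
  rw [regTerm_perm (.swap _ _ _) (.swap _ _ _)]
  unfold baileyTerm
  funext k
  congr 1
  · field_simp
  · simp only [List.cons.injEq, and_true]
    refine ⟨?_, ?_, ?_, ?_, ?_⟩ <;> field_simp
  · simp only [List.cons.injEq, and_true]
    refine ⟨?_, ?_, ?_, ?_, ?_⟩ <;> field_simp

lemma qPochsInf_ne_zero_of_notMem_poles (hq : ‖q‖ < 1) {x : ℂ} (hz : z ≠ 0) (h : z ∉ poles q x) :
    qPochsInf q [x * z, x / z] ≠ 0 := by
  have hleft : qPochInf q (x * z) ≠ 0 := qPochInf_ne_zero hq fun j hj =>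
    h ⟨j, Or.inr (eq_inv_of_mul_eq_one_left (by linear_combination -hj))⟩
  have hright : qPochInf q (x / z) ≠ 0 := qPochInf_ne_zero hq fun j hj => h ⟨j, Or.inl (by
    field_simp at hj
    linear_combination hj)⟩
  simpa [qPochsInf] using And.intro hleft hright

lemma Phi_denominator_ne_zero (hq : ‖q‖ < 1) (hz : z ∈ admissible q b c d e) :
    qPochsInf q [c * z, c / z] ≠ 0 :=
  qPochsInf_ne_zero_of_notMem_poles hq hz.1 hz.2.1

lemma Psi_denominator_ne_zero (hq : ‖q‖ < 1) (hz : z ∈ admissible q b c d e) :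
    qPochsInf q [c ^ 2 * z / (b * d * e), c ^ 2 / (b * d * e * z)] ≠ 0 := by
  have h := qPochsInf_ne_zero_of_notMem_poles hq hz.1 hz.2.2
  rwa [div_mul_eq_mul_div, div_div] at h

lemma kernel_denominator_ne_zero (hq : ‖q‖ < 1) (hz : z ∈ admissible q b c d e) :
    qPochsInf q [c * z, c / z, c ^ 2 * z / (b * d * e), c ^ 2 / (b * d * e * z)] ≠ 0 := by
  simpa [qPochsInf, and_assoc] using
    And.intro (Phi_denominator_ne_zero hq hz) (Psi_denominator_ne_zero hq hz)

lemma first_denominator_ne_zero (hq : ‖q‖ < 1) (hgen : Generic q b c d e)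
    (hz : z ∈ admissible q b c d e) :
    qPochsInf q [q, b * c / d, b * c / e, b * d * e * q / c, c / z, c * z] ≠ 0 := by
  have hcoeff := qPochsInf_ne_zero_of_qPochs hq hgen.f_den'
  have hPhi := Phi_denominator_ne_zero hq hz
  simp only [qPochsInf, List.map_cons, List.map_nil, List.prod_cons, List.prod_nil, mul_one,
    mul_ne_zero_iff] at *
  tauto

lemma second_denominator_ne_zero (hq : ‖q‖ < 1) (hgen : Generic q b c d e)
    (hz : z ∈ admissible q b c d e) :
    qPochsInf q [q, c ^ 2 / (d * e ^ 2), c ^ 2 / (d ^ 2 * e), c * q / (b * d * e),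
      c ^ 2 / (b * d * e * z), c ^ 2 * z / (b * d * e)] ≠ 0 := by
  have hcoeff := qPochsInf_ne_zero_of_qPochs hq hgen.g_den'
  have hPsi := Psi_denominator_ne_zero hq hz
  simp only [qPochsInf, List.map_cons, List.map_nil, List.prod_cons, List.prod_nil, mul_one,
    mul_ne_zero_iff] at *
  tauto

lemma mul_tsum_fCoeff_mul_Phi (hq : ‖q‖ < 1) (hq0 : q ≠ 0) (hgen : Generic q b c d e)
    (hz : z ∈ admissible q b c d e) :
    (1 - b * c / q) * qPochsInf q [q, b * c / d, b * c / e, b * d * e * q / c, c / z, c * z] *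
        ∑' k, fCoeff q b c d e k * Phi q b c k z =
      baileySeries q (b * d * e / c) d e (b * z) (b / z) := by
  have hmap := map_first_denominators hq0 hgen.b_ne hgen.c_ne hgen.d_ne hgen.e_ne hz.1
  have hden := first_denominator_ne_zero hq hgen hz
  have h := mul_tsum_wTerm hq (bs := [d, e, c ^ 2 / (d * e * q), b * z, b / z]) hgen.f_den
    (by rwa [← div_eq_mul_inv, hmap])
  rw [← div_eq_mul_inv, hmap] at h
  simp only [fCoeff_mul_Phi hq0 hgen.b_ne hgen.c_ne hgen.d_ne hgen.e_ne hz.1]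
  rw [h, baileySeries, baileyTerm_first hq0 hgen.b_ne hgen.c_ne hgen.d_ne hgen.e_ne hz.1]

lemma mul_tsum_gCoeff_mul_Psi (hq : ‖q‖ < 1) (hq0 : q ≠ 0) (hgen : Generic q b c d e)
    (hz : z ∈ admissible q b c d e) :
    (1 - c ^ 3 / (b * d ^ 2 * e ^ 2 * q)) * qPochsInf q [q, c ^ 2 / (d * e ^ 2),
        c ^ 2 / (d ^ 2 * e), c * q / (b * d * e), c ^ 2 / (b * d * e * z),
        c ^ 2 * z / (b * d * e)] * ∑' k, gCoeff q b c d e k * Psi q b c d e k z =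
      baileySeries q (b * d * e / c)⁻¹ (d / (b * d * e / c)) (e / (b * d * e / c))
        (b * z / (b * d * e / c)) (b / z / (b * d * e / c)) := by
  have hmap := map_second_denominators hq0 hgen.b_ne hgen.c_ne hgen.d_ne hgen.e_ne hz.1
  have hden := second_denominator_ne_zero hq hgen hz
  have h := mul_tsum_wTerm hq (bs := [c / (b * d), c / (b * e), c ^ 2 / (d * e * q),
    c * z / (d * e), c / (d * e * z)]) hgen.g_den (by rwa [hmap])
  rw [hmap] at h
  simp only [gCoeff_mul_Psi hq0 hgen.b_ne hgen.c_ne hgen.d_ne hgen.e_ne hz.1]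
  rw [h, baileySeries, baileyTerm_second hq0 hgen.b_ne hgen.c_ne hgen.d_ne hgen.e_ne hz.1]

end KernelSeries

section KernelIdentity

variable {q b c d e z : ℂ}

/-- A common multiple of the denominators of the three terms of the kernel identity, by which
`F z` becomes the product of `baileyDiff_eq_qPochsInf`. -/
def kernelDen (q b c d e z : ℂ) : ℂ :=
  (1 - b * c / q) * (1 - c ^ 3 / (b * d ^ 2 * e ^ 2 * q)) *
    qPochsInf q [q, b * d * e * q / c, b * c, c / b, b * c / (d * e), c / (b * d * e),
      c ^ 3 / (b * d ^ 2 * e ^ 2), c * z, c / z, c ^ 2 * z / (b * d * e),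
      c ^ 2 / (b * d * e * z)]

lemma kernelDen_ne_zero (hq : ‖q‖ < 1) (hgen : Generic q b c d e)
    (hz : z ∈ admissible q b c d e) : kernelDen q b c d e z ≠ 0 := by
  have hfirst := first_denominator_ne_zero hq hgen hz
  have hPsi := Psi_denominator_ne_zero hq hz
  have hH := hgen.H_den
  have hK := hgen.K_den
  have hf := hgen.f_den
  have hg := hgen.g_den
  rw [← div_eq_mul_inv] at hf
  simp only [kernelDen, qPochsInf, List.map_cons, List.map_nil, List.prod_cons, List.prod_nil,
    mul_one, mul_ne_zero_iff] at *
  tauto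

lemma H_at_b (q b c d e : ℂ) : H q c d e b =
    qPochsInf q [b * c / d, c / (b * d), b * c / e, c / (b * e)] /
      qPochsInf q [b * c, c / b, b * c / (d * e), c / (b * d * e)] := by
  rw [H, mul_comm c b, mul_comm d b, mul_comm e b, mul_comm (d * e) b, ← mul_assoc b d e]

lemma K_at_c_div (hc : c ≠ 0) (hd : d ≠ 0) (he : e ≠ 0) :
    K q b c d e (c / (d * e)) =
      qPochsInf q [c ^ 2 / (d ^ 2 * e), e, c ^ 2 / (d * e ^ 2), d] /
        qPochsInf q [b * c / (d * e), b * d * e / c, c ^ 3 / (b * d ^ 2 * e ^ 2), c / b] := by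
  rw [K]
  congr 2
  · simp only [List.cons.injEq, and_true]
    refine ⟨?_, ?_, ?_, ?_⟩ <;> field_simp
  · simp only [List.cons.injEq, and_true]
    refine ⟨?_, ?_, ?_, ?_⟩ <;> field_simp

lemma kernelDen_mul_F (hq : ‖q‖ < 1) (hq0 : q ≠ 0) (hgen : Generic q b c d e)
    (hz : z ∈ admissible q b c d e) :
    kernelDen q b c d e z * F q b c d e z =
      baileyDiff q (b * d * e / c) d e (b * z) (b / z) := by
  have hb := hgen.b_ne
  have hc := hgen.c_ne
  have hd := hgen.d_ne
  have he := hgen.e_ne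
  have hz0 := hz.1
  have hF : F q b c d e z * qPochsInf q [c * z, c / z, c ^ 2 * z / (b * d * e),
      c ^ 2 / (b * d * e * z)] = _ :=
    div_mul_cancel₀ _ (kernel_denominator_ne_zero hq hz)
  have hargs : [q, b * d * e / c * q, (b * d * e / c)⁻¹,
      d * e * (b * z) * (b / z) / (b * d * e / c * q),
      d * e * (b * z) * (b / z) / ((b * d * e / c) ^ 3 * q),
      d * e / (b * d * e / c), d * (b * z) / (b * d * e / c), d * (b / z) / (b * d * e / c),
      e * (b * z) / (b * d * e / c), e * (b / z) / (b * d * e / c),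
      b * z * (b / z) / (b * d * e / c)] =
      [q, b * d * e * q / c, c / (b * d * e), b * c / q, c ^ 3 / (b * d ^ 2 * e ^ 2) / q,
        c / b, c * z / e, c / (e * z), c * z / d, c / (d * z), b * c / (d * e)] := by
    simp only [List.cons.injEq, and_true, true_and]
    refine ⟨?_, ?_, ?_, ?_, ?_, ?_, ?_, ?_, ?_, ?_⟩ <;> field_simp
  rw [baileyDiff_eq_qPochsInf hq hq0 (by simp [*]), hargs, kernelDen]
  simp only [qPochsInf, List.map_cons, List.map_nil, List.prod_cons, List.prod_nil, mul_one,
    qPochInf_div_self hq hq0] at hF ⊢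
  linear_combination (1 - b * c / q) * (1 - c ^ 3 / (b * d ^ 2 * e ^ 2 * q)) * (qPochInf q q *
    qPochInf q (b * d * e * q / c) * qPochInf q (b * c) * qPochInf q (c / b) *
    qPochInf q (b * c / (d * e)) * qPochInf q (c / (b * d * e)) *
    qPochInf q (c ^ 3 / (b * d ^ 2 * e ^ 2))) * hF

lemma baileySum_first (hq : ‖q‖ < 1) (hq0 : q ≠ 0) (hgen : Generic q b c d e)
    (hz : z ∈ admissible q b c d e) :
    baileySum q (b * d * e / c) d e (b * z) (b / z) =
      qPochsInf q [c ^ 3 / (b * d ^ 2 * e ^ 2) / q, c / (b * e), c / (b * d), c * z / (d * e),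
        c / (d * e * z)] *
        ((1 - b * c / q) *
          qPochsInf q [q, b * c / d, b * c / e, b * d * e * q / c, c / z, c * z] *
          ∑' k, fCoeff q b c d e k * Phi q b c k z) := by
  have := hgen.b_ne
  have := hgen.c_ne
  have := hgen.d_ne
  have := hgen.e_ne
  have := hz.1
  rw [baileySum, mul_tsum_fCoeff_mul_Phi hq hq0 hgen hz]
  congr 2
  simp only [List.cons.injEq, and_true]
  refine ⟨?_, ?_, ?_, ?_, ?_⟩ <;> field_simp

lemma baileySum_second (hq : ‖q‖ < 1) (hq0 : q ≠ 0) (hgen : Generic q b c d e)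
    (hz : z ∈ admissible q b c d e) :
    baileySum q (b * d * e / c)⁻¹ (d / (b * d * e / c)) (e / (b * d * e / c))
        (b * z / (b * d * e / c)) (b / z / (b * d * e / c)) =
      qPochsInf q [b * c / q, d, e, b * z, b / z] *
        ((1 - c ^ 3 / (b * d ^ 2 * e ^ 2 * q)) * qPochsInf q [q, c ^ 2 / (d * e ^ 2),
          c ^ 2 / (d ^ 2 * e), c * q / (b * d * e), c ^ 2 / (b * d * e * z),
          c ^ 2 * z / (b * d * e)] * ∑' k, gCoeff q b c d e k * Psi q b c d e k z) := by
  have := hgen.b_ne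
  have := hgen.c_ne
  have := hgen.d_ne
  have := hgen.e_ne
  have := hz.1
  rw [baileySum, mul_tsum_gCoeff_mul_Psi hq hq0 hgen hz]
  congr 2
  simp only [List.cons.injEq, and_true]
  refine ⟨?_, ?_, ?_, ?_, ?_⟩ <;> field_simp

lemma kernelDen_mul_first (hq : ‖q‖ < 1) (hq0 : q ≠ 0) (hgen : Generic q b c d e)
    (hz : z ∈ admissible q b c d e) :
    kernelDen q b c d e z *
        (A q b c d e z * H q c d e b * ∑' k, fCoeff q b c d e k * Phi q b c k z) =
      baileySum q (b * d * e / c) d e (b * z) (b / z) := by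
  have hA : A q b c d e z * _ = _ := div_mul_cancel₀ _ (Psi_denominator_ne_zero hq hz)
  have hH : H q c d e b * _ = _ := H_at_b q b c d e ▸ div_mul_cancel₀ _ hgen.H_den
  rw [baileySum_first hq hq0 hgen hz, kernelDen]
  simp only [qPochsInf, List.map_cons, List.map_nil, List.prod_cons, List.prod_nil, mul_one,
    qPochInf_div_self hq hq0] at hA hH ⊢
  generalize ∑' k, fCoeff q b c d e k * Phi q b c k z = S
  linear_combination (1 - b * c / q) * (1 - c ^ 3 / (b * d ^ 2 * e ^ 2 * q)) * (qPochInf q q *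
    qPochInf q (b * d * e * q / c) * qPochInf q (c ^ 3 / (b * d ^ 2 * e ^ 2)) *
    qPochInf q (c * z) * qPochInf q (c / z)) * S * (H q c d e b * (qPochInf q (b * c) *
      (qPochInf q (c / b) * (qPochInf q (b * c / (d * e)) * qPochInf q (c / (b * d * e))))) * hA +
      qPochInf q (c * z / (d * e)) * qPochInf q (c / (d * e * z)) * hH)

lemma kernelDen_mul_second (hq : ‖q‖ < 1) (hq0 : q ≠ 0) (hgen : Generic q b c d e)
    (hz : z ∈ admissible q b c d e) :
    kernelDen q b c d e z * (B q b c z * K q b c d e (c / (d * e)) *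
        ∑' k, gCoeff q b c d e k * Psi q b c d e k z) =
      -((b * d * e / c)⁻¹ * baileySum q (b * d * e / c)⁻¹ (d / (b * d * e / c))
        (e / (b * d * e / c)) (b * z / (b * d * e / c)) (b / z / (b * d * e / c))) := by
  have hb := hgen.b_ne
  have hc := hgen.c_ne
  have hd := hgen.d_ne
  have he := hgen.e_ne
  have hr : b * d * e / c ≠ 0 := by simp [*]
  have hB : B q b c z * _ = _ := div_mul_cancel₀ _ (Phi_denominator_ne_zero hq hz)
  have hK : K q b c d e (c / (d * e)) * _ = _ :=
    K_at_c_div hc hd he ▸ div_mul_cancel₀ _ hgen.K_den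
  have htheta := qPochInf_theta_inversion hq hr
  rw [inv_div, div_mul_eq_mul_div, div_div_eq_mul_div, mul_comm q c] at htheta
  rw [baileySum_second hq hq0 hgen hz, kernelDen, inv_div]
  simp only [qPochsInf, List.map_cons, List.map_nil, List.prod_cons, List.prod_nil, mul_one,
    qPochInf_div_self hq hq0] at hB hK ⊢
  generalize ∑' k, gCoeff q b c d e k * Psi q b c d e k z = S
  set p := (1 - b * c / q) * (1 - c ^ 3 / (b * d ^ 2 * e ^ 2 * q)) * (qPochInf q q *
    qPochInf q (b * c) * qPochInf q (c ^ 2 * z / (b * d * e)) *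
    qPochInf q (c ^ 2 / (b * d * e * z))) * S
  linear_combination p * (qPochInf q (c / b) * qPochInf q (b * c / (d * e)) *
    qPochInf q (c ^ 3 / (b * d ^ 2 * e ^ 2)) * K q b c d e (c / (d * e))) *
      (qPochInf q (c * z) * qPochInf q (c / z) * B q b c z) * htheta -
    p * (c / (b * d * e)) * qPochInf q (c * q / (b * d * e)) *
      (qPochInf q (c * z) * qPochInf q (c / z) * B q b c z * hK +
        qPochInf q (c ^ 2 / (d ^ 2 * e)) * qPochInf q e * qPochInf q (c ^ 2 / (d * e ^ 2)) *
          qPochInf q d * hB)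

theorem F_eq (hq : ‖q‖ < 1) (hq0 : q ≠ 0) (hgen : Generic q b c d e)
    (hz : z ∈ admissible q b c d e) :
    F q b c d e z =
      A q b c d e z * H q c d e b * ∑' k, fCoeff q b c d e k * Phi q b c k z +
        B q b c z * K q b c d e (c / (d * e)) *
          ∑' k, gCoeff q b c d e k * Psi q b c d e k z := by
  apply mul_left_cancel₀ (kernelDen_ne_zero hq hgen hz)
  rw [mul_add, kernelDen_mul_first hq hq0 hgen hz, kernelDen_mul_second hq hq0 hgen hz,
    kernelDen_mul_F hq hq0 hgen hz, baileyDiff, sub_eq_add_neg]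

end KernelIdentity

section UniformConvergence

variable {q : ℂ} {X : Type*} {s : Set X} {u : ℕ → X → ℂ} {C : ℝ}

lemma tendstoUniformlyOn_tsum_of_norm_le_mul_pow (hq : ‖q‖ < 1)
    (h : ∀ k, ∀ x ∈ s, ‖u k x‖ ≤ C * ‖q‖ ^ k) :
    TendstoUniformlyOn (fun N x => ∑ k ∈ Finset.range N, u k x) (fun x => ∑' k, u k x) atTop s :=
  tendstoUniformlyOn_tsum_nat ((summable_geometric_of_lt_one (norm_nonneg q) hq).mul_left C) h

variable [TopologicalSpace X]

lemma tendstoUniformlyOn_mul_tsum_of_norm_le_mul_pow (hq : ‖q‖ < 1) (hs : IsCompact s)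
    {g : X → ℂ} (hg : ContinuousOn g s) (h : ∀ k, ∀ x ∈ s, ‖u k x‖ ≤ C * ‖q‖ ^ k) :
    TendstoUniformlyOn (fun N x => g x * ∑ k ∈ Finset.range N, u k x)
      (fun x => g x * ∑' k, u k x) atTop s := by
  obtain ⟨M, hM⟩ := hs.exists_bound_of_continuousOn hg
  simp only [Finset.mul_sum, ← tsum_mul_left]
  refine tendstoUniformlyOn_tsum_of_norm_le_mul_pow hq (C := M * C) fun k x hx => ?_
  rw [norm_mul, mul_assoc]
  exact mul_le_mul (hM x hx) (h k x hx) (norm_nonneg _) ((norm_nonneg _).trans (hM x hx))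

lemma exists_norm_wTerm_le (hq : ‖q‖ < 1) (hs : IsCompact s) (a : ℂ) {bs : List (X → ℂ)}
    (hbs : ∀ b ∈ bs, ContinuousOn b s) (hbs0 : ∀ b ∈ bs, ∀ x ∈ s, b x ≠ 0)
    (hden : ∀ x ∈ s, qPochsInf q (q :: (bs.map (· x)).map (a * q / ·)) ≠ 0) :
    ∃ C : ℝ, ∀ k, ∀ x ∈ s, ‖wTerm q a (bs.map (· x)) q k‖ ≤ C * ‖q‖ ^ k := by
  let cs : List (X → ℂ) := bs.map fun b x => a * q / b x
  have map_cs (x : X) : (bs.map (· x)).map (a * q / ·) = cs.map (· x) := by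
    simp only [cs, List.map_map, Function.comp_def]
  have hcs : ∀ c ∈ cs, ContinuousOn c s :=
    List.forall_mem_map.2 fun b hb => continuousOn_const.div (hbs b hb) (hbs0 b hb)
  have hdenCont : ContinuousOn (fun x => qPochsInf q (q :: cs.map (· x))) s :=
    continuousOn_qPochsInf hq (bs := (fun _ => q) :: cs) (by simpa using ⟨continuousOn_const, hcs⟩)
  simp only [map_cs] at hden
  obtain ⟨C, hC⟩ := hs.exists_bound_of_continuousOn <|
    ((continuousOn_regTermBound q continuousOn_const hbs hcs).div hdenCont.norm
      fun x hx => norm_ne_zero_iff.2 (hden x hx)).div_const ‖1 - a‖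
  refine ⟨C, fun k x hx => ?_⟩
  rw [wTerm_eq_regTerm_div hq a (by rw [map_cs]; exact hden x hx), map_cs, norm_div, norm_mul]
  calc ‖regTerm q a (bs.map (· x)) (cs.map (· x)) k‖ /
        (‖1 - a‖ * ‖qPochsInf q (q :: cs.map (· x))‖)
      ≤ regTermBound q a (bs.map (· x)) (cs.map (· x)) * ‖q‖ ^ k /
        (‖1 - a‖ * ‖qPochsInf q (q :: cs.map (· x))‖) := by
        gcongr
        exact norm_regTerm_le hq a _ _ k
    _ = regTermBound q a (bs.map (· x)) (cs.map (· x)) / ‖qPochsInf q (q :: cs.map (· x))‖ /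
        ‖1 - a‖ * ‖q‖ ^ k := by ring
    _ ≤ C * ‖q‖ ^ k := by
        gcongr
        exact (le_abs_self _).trans (hC x hx)

end UniformConvergence

section KernelConvergence

variable {q b c d e z : ℂ} {L : Set ℂ}

lemma exists_norm_fCoeff_mul_Phi_le (hq : ‖q‖ < 1) (hq0 : q ≠ 0) (hgen : Generic q b c d e)
    (hL : IsCompact L) (hadm : L ⊆ admissible q b c d e) :
    ∃ C : ℝ, ∀ k, ∀ z ∈ L, ‖fCoeff q b c d e k * Phi q b c k z‖ ≤ C * ‖q‖ ^ k := by
  have hb := hgen.b_ne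
  have hc := hgen.c_ne
  have hd := hgen.d_ne
  have he := hgen.e_ne
  have hL0 : ∀ z ∈ L, z ≠ 0 := fun z hz => (hadm hz).1
  obtain ⟨C, hC⟩ := exists_norm_wTerm_le hq hL (b * c / q)
    (bs := [fun _ => d, fun _ => e, fun _ => c ^ 2 / (d * e * q), fun z => b * z, fun z => b / z])
    (by
      simp only [List.forall_mem_cons, List.not_mem_nil, false_imp_iff, implies_true, and_true]
      refine ⟨?_, ?_, ?_, ?_, ?_⟩ <;> fun_prop (disch := assumption))
    (by simp_all) (fun z hz => by
      have h := first_denominator_ne_zero hq hgen (hadm hz)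
      rwa [← map_first_denominators hq0 hb hc hd he (hL0 z hz)] at h)
  refine ⟨C, fun k z hz => ?_⟩
  rw [fCoeff_mul_Phi hq0 hb hc hd he (hL0 z hz)]
  exact hC k z hz

lemma exists_norm_gCoeff_mul_Psi_le (hq : ‖q‖ < 1) (hq0 : q ≠ 0) (hgen : Generic q b c d e)
    (hL : IsCompact L) (hadm : L ⊆ admissible q b c d e) :
    ∃ C : ℝ, ∀ k, ∀ z ∈ L, ‖gCoeff q b c d e k * Psi q b c d e k z‖ ≤ C * ‖q‖ ^ k := by
  have hb := hgen.b_ne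
  have hc := hgen.c_ne
  have hd := hgen.d_ne
  have he := hgen.e_ne
  have hL0 : ∀ z ∈ L, z ≠ 0 := fun z hz => (hadm hz).1
  have hde : ∀ z ∈ L, d * e * z ≠ 0 := by simp_all
  obtain ⟨C, hC⟩ := exists_norm_wTerm_le hq hL (c ^ 3 / (b * d ^ 2 * e ^ 2 * q))
    (bs := [fun _ => c / (b * d), fun _ => c / (b * e), fun _ => c ^ 2 / (d * e * q),
      fun z => c * z / (d * e), fun z => c / (d * e * z)])
    (by
      simp only [List.forall_mem_cons, List.not_mem_nil, false_imp_iff, implies_true, and_true]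
      refine ⟨?_, ?_, ?_, ?_, ?_⟩ <;> fun_prop (disch := assumption))
    (by simp_all) (fun z hz => by
      have h := second_denominator_ne_zero hq hgen (hadm hz)
      rwa [← map_second_denominators hq0 hb hc hd he (hL0 z hz)] at h)
  refine ⟨C, fun k z hz => ?_⟩
  rw [gCoeff_mul_Psi hq0 hb hc hd he (hL0 z hz)]
  exact hC k z hz

lemma summable_fCoeff_mul_Phi (hq : ‖q‖ < 1) (hq0 : q ≠ 0) (hgen : Generic q b c d e)
    (hz : z ∈ admissible q b c d e) : Summable fun k => fCoeff q b c d e k * Phi q b c k z := by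
  obtain ⟨C, hC⟩ := exists_norm_fCoeff_mul_Phi_le hq hq0 hgen isCompact_singleton
    (Set.singleton_subset_iff.2 hz)
  exact summable_of_norm_le_mul_pow hq fun k => hC k z rfl

lemma summable_gCoeff_mul_Psi (hq : ‖q‖ < 1) (hq0 : q ≠ 0) (hgen : Generic q b c d e)
    (hz : z ∈ admissible q b c d e) :
    Summable fun k => gCoeff q b c d e k * Psi q b c d e k z := by
  obtain ⟨C, hC⟩ := exists_norm_gCoeff_mul_Psi_le hq hq0 hgen isCompact_singleton
    (Set.singleton_subset_iff.2 hz)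
  exact summable_of_norm_le_mul_pow hq fun k => hC k z rfl

lemma continuousOn_qPochsInf_mul_div (hq : ‖q‖ < 1) (hL : ∀ z ∈ L, z ≠ 0) (x : ℂ) :
    ContinuousOn (fun z => qPochsInf q [x * z, x / z]) L :=
  continuousOn_qPochsInf hq (bs := [fun z => x * z, fun z => x / z]) <| by
    simp only [List.forall_mem_cons, List.not_mem_nil, false_imp_iff, implies_true, and_true]
    constructor <;> fun_prop (disch := assumption)

lemma continuousOn_A (hq : ‖q‖ < 1) :
    ContinuousOn (A q b c d e) (admissible q b c d e) := by
  have hz : ∀ z ∈ admissible q b c d e, z ≠ 0 := fun z hz => hz.1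
  have hnum := continuousOn_qPochsInf_mul_div hq hz (c / (d * e))
  have hden := continuousOn_qPochsInf_mul_div hq hz (c ^ 2 / (b * d * e))
  simp only [div_mul_eq_mul_div, div_div] at hnum hden
  exact hnum.div hden fun z hz => Psi_denominator_ne_zero hq hz

lemma continuousOn_B (hq : ‖q‖ < 1) : ContinuousOn (B q b c) (admissible q b c d e) := by
  have hz : ∀ z ∈ admissible q b c d e, z ≠ 0 := fun z hz => hz.1
  exact (continuousOn_qPochsInf_mul_div hq hz b).div (continuousOn_qPochsInf_mul_div hq hz c)
    fun z hz => Phi_denominator_ne_zero hq hz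

theorem tendstoUniformlyOn_F (hq : ‖q‖ < 1) (hq0 : q ≠ 0) (hgen : Generic q b c d e)
    (hL : IsCompact L) (hadm : L ⊆ admissible q b c d e) :
    TendstoUniformlyOn
      (fun N z =>
        A q b c d e z * H q c d e b * ∑ k ∈ Finset.range N, fCoeff q b c d e k * Phi q b c k z +
          B q b c z * K q b c d e (c / (d * e)) *
            ∑ k ∈ Finset.range N, gCoeff q b c d e k * Psi q b c d e k z)
      (F q b c d e) atTop L := by
  obtain ⟨Cf, hf⟩ := exists_norm_fCoeff_mul_Phi_le hq hq0 hgen hL hadm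
  obtain ⟨Cg, hg⟩ := exists_norm_gCoeff_mul_Psi_le hq hq0 hgen hL hadm
  have hA := ((continuousOn_A hq).mono hadm).mul_const (H q c d e b)
  have hB := ((continuousOn_B hq).mono hadm).mul_const (K q b c d e (c / (d * e)))
  refine ((tendstoUniformlyOn_mul_tsum_of_norm_le_mul_pow hq hL hA hf).add
    (tendstoUniformlyOn_mul_tsum_of_norm_le_mul_pow hq hL hB hg)).congr_right ?_
  exact fun z hz => (F_eq hq hq0 hgen (hadm hz)).symm

lemma fCoeff_mul_Phi_eq_expanded (q b c d e z : ℂ) (k : ℕ) :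
    fCoeff q b c d e k * Phi q b c k z =
      (1 - b * c * q ^ (2 * (k : ℤ) - 1)) / (1 - b * c * q⁻¹) *
        (qPochs q [b * c * q⁻¹, d, e, c ^ 2 / (d * e * q), b * z, b / z] k /
          qPochs q [q, b * c / d, b * c / e, b * d * e * q / c, c * z, c / z] k) * q ^ k := by
  simp only [fCoeff, Phi, qPochs, List.map_cons, List.map_nil, List.prod_cons, List.prod_nil,
    mul_one]
  ring

lemma gCoeff_mul_Psi_eq_expanded (q b c d e z : ℂ) (k : ℕ) :
    gCoeff q b c d e k * Psi q b c d e k z =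
      (1 - c ^ 3 * q ^ (2 * (k : ℤ) - 1) / (b * d ^ 2 * e ^ 2)) /
          (1 - c ^ 3 / (b * d ^ 2 * e ^ 2 * q)) *
        (qPochs q [c ^ 3 / (b * d ^ 2 * e ^ 2 * q), c / (b * d), c / (b * e),
            c ^ 2 / (d * e * q), c * z / (d * e), c / (d * e * z)] k /
          qPochs q [q, c ^ 2 / (d * e ^ 2), c ^ 2 / (d ^ 2 * e), c * q / (b * d * e),
            c ^ 2 * z / (b * d * e), c ^ 2 / (b * d * e * z)] k) * q ^ k := by
  simp only [gCoeff, Psi, qPochs, List.map_cons, List.map_nil, List.prod_cons, List.prod_nil,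
    mul_one]
  ring

end KernelConvergence

end TwoBasis

end

theorem mainTheorem1 (q b c d e : ℂ) (hq0 : 0 < ‖q‖) (hq1 : ‖q‖ < 1)
    (hgen : Generic q b c d e) :
    -- convergence and the identity at every admissible point
    (∀ z ∈ admissible q b c d e,
      Summable (fun k : ℕ => fCoeff q b c d e k * Phi q b c k z) ∧
      Summable (fun k : ℕ => gCoeff q b c d e k * Psi q b c d e k z) ∧
      F q b c d e z =
        A q b c d e z * H q c d e b * ∑' k : ℕ, fCoeff q b c d e k * Phi q b c k z +
        B q b c z * K q b c d e (c / (d * e)) *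
          ∑' k : ℕ, gCoeff q b c d e k * Psi q b c d e k z) ∧
    -- uniform convergence on symmetric pole-free compact sets
    (∀ L : Set ℂ, IsCompact L → (∀ z ∈ L, z⁻¹ ∈ L) → L ⊆ admissible q b c d e →
      TendstoUniformlyOn
        (fun (N : ℕ) (z : ℂ) => ∑ k ∈ Finset.range N, fCoeff q b c d e k * Phi q b c k z)
        (fun z => ∑' k : ℕ, fCoeff q b c d e k * Phi q b c k z) Filter.atTop L ∧
      TendstoUniformlyOn
        (fun (N : ℕ) (z : ℂ) => ∑ k ∈ Finset.range N, gCoeff q b c d e k * Psi q b c d e k z)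
        (fun z => ∑' k : ℕ, gCoeff q b c d e k * Psi q b c d e k z) Filter.atTop L ∧
      TendstoUniformlyOn
        (fun (N : ℕ) (z : ℂ) =>
          A q b c d e z * H q c d e b *
            ∑ k ∈ Finset.range N, fCoeff q b c d e k * Phi q b c k z +
          B q b c z * K q b c d e (c / (d * e)) *
            ∑ k ∈ Finset.range N, gCoeff q b c d e k * Psi q b c d e k z)
        (F q b c d e) Filter.atTop L) ∧
    -- the expanded form
    (∀ z ∈ admissible q b c d e,
      qPochsInf q [c * z / d, c / (d * z), c * z / e, c / (e * z)] /
          qPochsInf q [c * z, c / z, c ^ 2 * z / (b * d * e), c ^ 2 / (b * d * e * z)] =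
        qPochsInf q [c * z / (d * e), c / (d * e * z)] /
            qPochsInf q [c ^ 2 * z / (b * d * e), c ^ 2 / (b * d * e * z)] * H q c d e b *
          ∑' k : ℕ, (1 - b * c * q ^ (2 * (k : ℤ) - 1)) / (1 - b * c * q⁻¹) *
            (qPochs q [b * c * q⁻¹, d, e, c ^ 2 / (d * e * q), b * z, b / z] k /
              qPochs q [q, b * c / d, b * c / e, b * d * e * q / c, c * z, c / z] k) * q ^ k +
        qPochsInf q [b * z, b / z] / qPochsInf q [c * z, c / z] *
            K q b c d e (c / (d * e)) *
          ∑' k : ℕ, (1 - c ^ 3 * q ^ (2 * (k : ℤ) - 1) / (b * d ^ 2 * e ^ 2)) /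
              (1 - c ^ 3 / (b * d ^ 2 * e ^ 2 * q)) *
            (qPochs q [c ^ 3 / (b * d ^ 2 * e ^ 2 * q), c / (b * d), c / (b * e),
                c ^ 2 / (d * e * q), c * z / (d * e), c / (d * e * z)] k /
              qPochs q [q, c ^ 2 / (d * e ^ 2), c ^ 2 / (d ^ 2 * e), c * q / (b * d * e),
                c ^ 2 * z / (b * d * e), c ^ 2 / (b * d * e * z)] k) * q ^ k) ∧
    -- the nonterminating very-well-poised `₈W₇` form
    (∀ z ∈ admissible q b c d e,
      F q b c d e z =
        A q b c d e z * H q c d e b *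
          ∑' k : ℕ, wTerm q (b * c / q) [d, e, c ^ 2 / (d * e * q), b * z, b / z] q k +
        B q b c z * K q b c d e (c / (d * e)) *
          ∑' k : ℕ, wTerm q (c ^ 3 / (b * d ^ 2 * e ^ 2 * q))
            [c / (b * d), c / (b * e), c ^ 2 / (d * e * q), c * z / (d * e), c / (d * e * z)]
            q k) := by
  have hq : q ≠ 0 := norm_pos_iff.1 hq0
  have hidentity := fun z (hz : z ∈ admissible q b c d e) => F_eq hq1 hq hgen hz
  refine ⟨fun z hz => ⟨summable_fCoeff_mul_Phi hq1 hq hgen hz,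
    summable_gCoeff_mul_Psi hq1 hq hgen hz, hidentity z hz⟩, fun L hL _ hadm => ⟨?_, ?_,
    tendstoUniformlyOn_F hq1 hq hgen hL hadm⟩, fun z hz => ?_, fun z hz => ?_⟩
  · obtain ⟨C, hC⟩ := exists_norm_fCoeff_mul_Phi_le hq1 hq hgen hL hadm
    exact tendstoUniformlyOn_tsum_of_norm_le_mul_pow hq1 hC
  · obtain ⟨C, hC⟩ := exists_norm_gCoeff_mul_Psi_le hq1 hq hgen hL hadm
    exact tendstoUniformlyOn_tsum_of_norm_le_mul_pow hq1 hC
  · simp only [← fCoeff_mul_Phi_eq_expanded, ← gCoeff_mul_Psi_eq_expanded]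
    exact hidentity z hz
  · simp only [hidentity z hz,
      fCoeff_mul_Phi hq hgen.b_ne hgen.c_ne hgen.d_ne hgen.e_ne hz.1,
      gCoeff_mul_Psi hq hgen.b_ne hgen.c_ne hgen.d_ne hgen.e_ne hz.1]
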